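/- Let $k\ge 1$, let $V$ be a real vector space of dimension $k+1$, let $J\subset\mathbb R$ be a nonempty open interval and let $\gamma\colon J\to P(V)$ be a smooth non-degenerate curve: $\gamma(t)=\langle v(t)\rangle$ for a smooth $v\colon J\to V$ such that $v(t),v'(t),\dots,v^{(k)}(t)$ are linearly independent for every $t\in J$. Let $\gamma^{(i)}(t)=\langle v(t),\dots,v^{(i)}(t)\rangle$ denote its osculating spaces (they do not depend on the lift $v$). Wilczynski invariants. Let $x,h,y$ be the $(k+1)\times(k+1)$ matrices, with rows and columns numbered $0,\dots,k$, given by $x_{i+1,i}=1$, $h=\operatorname{diag}(k,k-2,\dots,-k)$, $y_{i,i+1}=(i+1)(k-i)$ and all other entries zero. A canonical frame of $\gamma$ over an open set $U\subset J$ is a smooth family of bases $e=(e_0(t),\dots,e_k(t))$ of $V$, $t\in U$, with $\langle e_0(t),\dots,e_i(t)\rangle=\gamma^{(i)}(t)$ for $0\le i\le k$, such that the matrix $C(t)$ defined by $e_j'=\sum_i C_{ij}e_i$ has the form $$C=\alpha x+\beta h+\eta y+\sum_{m=2}^{k}\theta_{m+1}\,y^m .$$ The coefficients $\theta_3,\dots,\theta_{k+1}$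 are the Wilczynski invariants of $\gamma$ (as coefficients of $dt$ in the frame $e$). We say that $\theta_j$ vanishes identically if it is zero on $U$ for every such $U$ and every canonical frame over $U$. Compatibility. A bilinear form $b$ on $V$ is compatible with $\gamma$ if $b(\gamma^{(i)}(t),\gamma^{(k-2-i)}(t))=0$ for all $t\in J$ and $0\le i\le k-2$, and strongly compatible with $\gamma$ if $b(\gamma^{(i)}(t),\gamma^{(k-1-i)}(t))=0$ for all $t\in J$ and $0\le i\le k-1$ (for non-degenerate $b$: $\gamma^{(i)}$ and $\gamma^{(k-1-i)}$ are orthogonal complements of each other, so $b\colon V\to V^*$ maps $\gamma$ to its dual curve of osculating hyperplanes). Lemma. (1) $\gamma$ has a canonical frame over the whole of $J$. (2) There is a non-degenerate bilinear form $b$ on $V$, symmetric if $\dim V$ is odd and skew-symmetric if $\dim V$ is even, that is compatible with $\gamma$, if and only if all Wilczynski invariants $\theta_{2i+1}$, $i=1,\dots,[(\dim V-1)/2]$, of $\gamma$ vanish identically. (3) Every non-degenerate bilinear form strongly compatible with $\gamma$ is symmetric if $\dim V$ is odd and skew-symmetric if $\dim V$ is even. (4) A non-degenerate bilinear form strongly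 compatible with $\gamma$ exists if and only if all $\theta_{2i+1}$, $i=1,\dots,[(\dim V-1)/2]$, vanish identically. -/

import Mathlib

open scoped ContDiff

namespace ProjCurve

/-! ### Curves in a projective space -/

section Curve

variable {V : Type*} [NormedAddCommGroup V] [NormedSpace ℝ V]

/-- `v` is a smooth lift to `V` of the curve `γ : J → P(V)`, that is, `γ(t) = ⟨v(t)⟩` for `t ∈ J`
(in particular `v(t) ≠ 0`, because points of `P(V)` are lines). -/
structure IsLift (γ : ℝ → Projectivization ℝ V) (J : Set ℝ) (v : ℝ → V) : Prop where
  smooth : ContDiffOn ℝ ∞ v J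
  span_eq : ∀ t ∈ J, (γ t).submodule = Submodule.span ℝ {v t}

/-- The osculating space `γ^{(i)}(t)`: the span of the derivatives of order at most `i` at `t` of
the smooth lifts of `γ`. (By the Leibniz rule each single lift already gives the same span.) -/
def osculatingSpace (γ : ℝ → Projectivization ℝ V) (J : Set ℝ) (i : ℕ) (t : ℝ) : Submodule ℝ V :=
  Submodule.span ℝ {w | ∃ v : ℝ → V, IsLift γ J v ∧ ∃ j ≤ i, w = iteratedDeriv j v t}

/-- `γ : J → P(V)`, `dim V = k + 1`, is smooth and non-degenerate: it has a smooth lift `v` such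
that `v(t), v'(t), …, v^{(k)}(t)` are linearly independent for all `t ∈ J`. -/
def IsNondegenerate (k : ℕ) (γ : ℝ → Projectivization ℝ V) (J : Set ℝ) : Prop :=
  ∃ v : ℝ → V, IsLift γ J v ∧
    ∀ t ∈ J, LinearIndependent ℝ (fun i : Fin (k + 1) => iteratedDeriv (i : ℕ) v t)

/-- `b(γ^{(i)}, γ^{(n)}) = 0` whenever `i, n ≥ 0` and `i + n = k - 2`. -/
def IsCompatible (k : ℕ) (γ : ℝ → Projectivization ℝ V) (J : Set ℝ)
    (b : LinearMap.BilinForm ℝ V) : Prop :=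
  ∀ t ∈ J, ∀ i n : ℕ, i + n + 2 = k →
    ∀ u ∈ osculatingSpace γ J i t, ∀ w ∈ osculatingSpace γ J n t, b u w = 0

/-- `b(γ^{(i)}, γ^{(n)}) = 0` whenever `i, n ≥ 0` and `i + n = k - 1`. As `dim γ^{(i)} = i + 1`,
for non-degenerate `b` this says that `γ^{(i)}` and `γ^{(k-1-i)}` are orthogonal complements;
for `i = 0`, that `b : V → V*` maps `γ` to its dual curve of osculating hyperplanes. -/
def IsStronglyCompatible (k : ℕ) (γ : ℝ → Projectivization ℝ V) (J : Set ℝ)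
    (b : LinearMap.BilinForm ℝ V) : Prop :=
  ∀ t ∈ J, ∀ i n : ℕ, i + n + 1 = k →
    ∀ u ∈ osculatingSpace γ J i t, ∀ w ∈ osculatingSpace γ J n t, b u w = 0

/-- `b` is symmetric if `dim V` is odd and skew-symmetric (alternating) if `dim V` is even. -/
def HasParitySymmetry (b : LinearMap.BilinForm ℝ V) : Prop :=
  (Odd (Module.finrank ℝ V) → b.IsSymm) ∧ (Even (Module.finrank ℝ V) → b.IsAlt)

end Curve

/-! ### The irreducible `sl(2)` in `sl(k+1)` -/

/-- The element of degree `-1`: ones just below the diagonal. -/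
def matX (k : ℕ) : Matrix (Fin (k + 1)) (Fin (k + 1)) ℝ :=
  Matrix.of fun i j => if (i : ℕ) = (j : ℕ) + 1 then 1 else 0

/-- `h = diag(k, k-2, …, -k)`. -/
def matH (k : ℕ) : Matrix (Fin (k + 1)) (Fin (k + 1)) ℝ :=
  Matrix.diagonal fun i => (k : ℝ) - 2 * (i : ℕ)

/-- The element of degree `1`, with entries `(i+1)(k-i)` at the places `(i, i+1)`. -/
def matY (k : ℕ) : Matrix (Fin (k + 1)) (Fin (k + 1)) ℝ :=
  Matrix.of fun i j => if (j : ℕ) = (i : ℕ) + 1 then ((i : ℕ) + 1 : ℝ) * ((k : ℝ) - (i : ℕ)) else 0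

/-! ### Canonical moving frames and Wilczynski invariants -/

section Frame

variable {V : Type*} [NormedAddCommGroup V] [NormedSpace ℝ V]

/-- A (local) section over `U` of the canonical moving frame bundle of `γ : J → P(V)`,
`dim V = k + 1`: a smooth family of bases `e₀(t), …, e_k(t)` of `V`, adapted to the osculating flag
of `γ`, whose Maurer-Cartan matrix `e⁻¹ e'` lies in `ℝ x + ⟨h, y⟩ + ⟨y², …, y^k⟩`. This matrix is
traceless, so `e` has constant volume. Its component in `⟨y², …, y^k⟩` is
`θ₃ y² + θ₄ y³ + ⋯ + θ_{k+1} y^k`, and `θ₃, …, θ_{k+1}` are the Wilczynski invariants of `γ`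
(as coefficients of `dt` in the frame `e`). The values of `θ` at other indices are irrelevant. -/
structure CanonicalFrame (k : ℕ) (γ : ℝ → Projectivization ℝ V) (J U : Set ℝ) where
  /-- the frame -/
  e : ℝ → Fin (k + 1) → V
  /-- the coefficients of `x`, `h`, `y` in the Maurer-Cartan matrix -/
  cx : ℝ → ℝ
  ch : ℝ → ℝ
  cy : ℝ → ℝ
  /-- the Wilczynski invariants -/
  θ : ℕ → ℝ → ℝ
  smooth : ∀ j, ContDiffOn ℝ ∞ (fun t => e t j) U
  linearIndependent : ∀ t ∈ U, LinearIndependent ℝ (e t)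
  adapted : ∀ t ∈ U, ∀ i : Fin (k + 1),
    Submodule.span ℝ {w | ∃ j ≤ i, w = e t j} = osculatingSpace γ J (i : ℕ) t
  structure_eq : ∀ t ∈ U, ∀ j : Fin (k + 1),
    deriv (fun s => e s j) t = ∑ i : Fin (k + 1),
      (cx t • matX k + ch t • matH k + cy t • matY k
        + ∑ m ∈ Finset.Icc 2 k, θ (m + 1) t • matY k ^ m) i j • e t i

/-- All `θ_{2i+1}`, `i = 1, …, [k/2]`, vanish identically on the canonical frame bundle of `γ`,
that is, on each of its local sections. -/
def OddWilczynskiVanish (k : ℕ) (γ : ℝ → Projectivization ℝ V) (J : Set ℝ) : Prop :=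
  ∀ U : Set ℝ, IsOpen U → U ⊆ J → ∀ F : CanonicalFrame k γ J U,
    ∀ i : ℕ, 1 ≤ i → i ≤ k / 2 → ∀ t ∈ U, F.θ (2 * i + 1) t = 0

end Frame

end ProjCurve

/-! Existence of a canonical frame. Rescale the lift `v` so that `v^{(k+1)}` has no component along
`v^{(k)}` (`exists_normalized_lift`). Take the coefficients `1` at `x`, `0` at `h` and unknown `c m`
at `y ^ m`; the structure equations then define `e_{j+1}` recursively from `e_0 = v`, each `e_j`
being `v^{(j)}` plus lower derivatives, and only the closing condition `e_{k+1} = 0` remains.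
Changing `c m` moves the component of `e_{k+1}` along `v^{(k-m)}` by a nonzero multiple of the
change and leaves the higher components alone. Hence `c 1, …, c k` can be chosen one after another
to kill all components (`exists_frameSeq_isComb`).

From a form to the invariants. A fixed form `b` has Gram entries `M_{ij} = b(e_i, e_j)`, which
satisfy a linear differential system dictated by the structure equations. Strong compatibility says
that `M` vanishes above the antidiagonal `i + j = k`. One differentiation shows that the
antidiagonal alternates in sign; each further diagonal satisfies a telescoping relation with zero
boundary values, whose increments are one number times positive weights (`eq_zero_of_telescoping`).
So the diagonal vanishes and so does the number, which for even `d` is a nonzero multiple of `c d *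
M_{0k}`. Thus `M` is antidiagonal and alternating, which gives the parity of `b`, and if `b` is
non-degenerate then `M_{0k} ≠ 0` and the `c d = θ_{d+1}` with `d` even vanish
(`gram_eq_zero_and_coeff`).

From the invariants to a form. The `sl(2)`-invariant form is preserved infinitesimally by `x`, `h`,
`y` and by the odd powers of `y`. If the even powers are absent, the form with this constant matrix
in the moving frame does not depend on `t` (`IsCanonicalSeq.exists_bilinForm`).

Plain compatibility together with the parity condition already forces strong compatibility
(`IsCompatible.isStronglyCompatible`), which links the two equivalences. -/

namespace ProjCurve

/-! ### Powers of `matY` -/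

/-- The entry of `matY k ^ m` at the place `(i, i + m)`. -/
noncomputable def yCoeff (k m i : ℕ) : ℝ :=
  ∏ l ∈ Finset.range m, ((i + l : ℕ) + 1 : ℝ) * ((k : ℝ) - (i + l : ℕ))

theorem yCoeff_pos {k m i : ℕ} (h : i + m ≤ k) : 0 < yCoeff k m i := by
  refine Finset.prod_pos fun l hl => mul_pos (by positivity) ?_
  rw [sub_pos, Nat.cast_lt]
  have := Finset.mem_range.1 hl
  omega

/-- The factor `(s + 1)(k - s)` is unchanged under `s ↦ k - 1 - s`. This symmetry of `y ^ m` about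
the antidiagonal lets the two halves of the derivative of a Gram entry add up for even `m` and
cancel for odd `m`. -/
theorem yCoeff_symm {k m i j : ℕ} (h : i + m + j = k) : yCoeff k m i = yCoeff k m j := by
  unfold yCoeff
  rw [← Finset.prod_range_reflect]
  refine Finset.prod_congr rfl fun l hl => ?_
  have hl' := Finset.mem_range.1 hl
  have h1 : i + (m - 1 - l) + 1 + (j + l) = k := by omega
  have h2 : ((i + (m - 1 - l) : ℕ) : ℝ) + 1 + (j + l : ℕ) = k := by exact_mod_cast h1
  rw [← h2]
  ring

theorem matY_pow_apply (k m : ℕ) (i j : Fin (k + 1)) :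
    (matY k ^ m) i j = if (j : ℕ) = i + m then yCoeff k m i else 0 := by
  induction m generalizing j with
  | zero => simp [yCoeff, Matrix.one_apply, Fin.ext_iff, eq_comm]
  | succ m ih =>
    rw [pow_succ, Matrix.mul_apply]
    have hY : ∀ l : Fin (k + 1), matY k l j =
        if (j : ℕ) = (l : ℕ) + 1 then ((l : ℕ) + 1 : ℝ) * ((k : ℝ) - (l : ℕ)) else 0 := fun l => rfl
    simp only [ih, hY]
    by_cases hj : (j : ℕ) = i + (m + 1)
    · have hm : (i : ℕ) + m < k + 1 := by omega
      rw [Finset.sum_eq_single ⟨i + m, hm⟩]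
      · simp [hj, yCoeff, Finset.prod_range_succ, add_assoc]
      · intro l _ hl
        rw [if_neg, zero_mul]
        exact fun h => hl (Fin.ext h)
      · simp
    · rw [if_neg hj]
      refine Finset.sum_eq_zero fun l _ => ?_
      by_cases hl : (l : ℕ) = i + m
      · rw [if_neg (by omega : ¬ (j : ℕ) = l + 1), mul_zero]
      · rw [if_neg hl, zero_mul]

/-! ### Columns of the Maurer-Cartan matrix -/

section

variable {V : Type*} [AddCommGroup V] [Module ℝ V]

theorem sum_matY_pow_smul {k j : ℕ} (m : ℕ) (hj : j < k + 1) (f : ℕ → V) :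
    ∑ i : Fin (k + 1), (matY k ^ m) i ⟨j, hj⟩ • f i =
      if m ≤ j then yCoeff k m (j - m) • f (j - m) else 0 := by
  simp only [matY_pow_apply]
  split_ifs with h
  · rw [Finset.sum_eq_single ⟨j - m, by omega⟩]
    · simp [h]
    · intro l _ hl
      rw [if_neg, zero_smul]
      exact fun h' => hl (Fin.ext (by simp at h' ⊢; omega))
    · simp
  · refine Finset.sum_eq_zero fun l _ => ?_
    rw [if_neg (by omega), zero_smul]

theorem sum_matX_smul {k j : ℕ} (hj : j < k + 1) (f : ℕ → V) (hf : f (k + 1) = 0) :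
    ∑ i : Fin (k + 1), matX k i ⟨j, hj⟩ • f i = f (j + 1) := by
  have hX : ∀ i : Fin (k + 1), matX k i ⟨j, hj⟩ = if (i : ℕ) = j + 1 then 1 else 0 := fun i => rfl
  simp only [hX]
  by_cases h : j = k
  · rw [show f (j + 1) = 0 by rw [h, hf]]
    refine Finset.sum_eq_zero fun l _ => ?_
    rw [if_neg (by omega), zero_smul]
  · rw [Finset.sum_eq_single ⟨j + 1, by omega⟩]
    · simp
    · intro l _ hl
      rw [if_neg, zero_smul]
      exact fun h' => hl (Fin.ext h')
    · simp

theorem sum_matH_smul {k j : ℕ} (hj : j < k + 1) (f : ℕ → V) :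
    ∑ i : Fin (k + 1), matH k i ⟨j, hj⟩ • f i = ((k : ℝ) - 2 * j) • f j := by
  rw [Finset.sum_eq_single ⟨j, hj⟩]
  · simp [matH]
  · intro l _ hl
    simp [matH, Matrix.diagonal_apply_ne _ hl]
  · simp

/-- Indexing the frame by `ℕ` with a zero in position `k + 1` makes the columns uniform, including
the last one, where `x` contributes nothing. The coefficient of `y` joins the others as the case `m
= 1`. -/
theorem sum_maurerCartan_smul {k j : ℕ} (hj : j < k + 1) (f : ℕ → V) (hf : f (k + 1) = 0)
    (a b y : ℝ) (θ : ℕ → ℝ) :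
    ∑ i : Fin (k + 1), (a • matX k + b • matH k + y • matY k
        + ∑ m ∈ Finset.Icc 2 k, θ (m + 1) • matY k ^ m) i ⟨j, hj⟩ • f i =
      a • f (j + 1) + (b * (k - 2 * j)) • f j
        + ∑ m ∈ Finset.Icc 1 j, ((if m = 1 then y else θ (m + 1)) * yCoeff k m (j - m)) •
            f (j - m) := by
  simp only [Matrix.add_apply, Matrix.smul_apply, Matrix.sum_apply, add_smul, Finset.sum_smul,
    Finset.sum_add_distrib, smul_assoc]
  rw [Finset.sum_comm]
  simp only [← Finset.smul_sum]
  have h1 := sum_matY_pow_smul (k := k) 1 hj f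
  rw [pow_one] at h1
  rw [sum_matX_smul hj f hf, sum_matH_smul hj f, h1, mul_smul, add_assoc (_ + _)]
  simp only [sum_matY_pow_smul]
  congr 1
  have h2 : ∀ m, (if m = 1 then y else θ (m + 1)) •
      (if m ≤ j then yCoeff k m (j - m) • f (j - m) else 0) = if m ≤ j then
        (((if m = 1 then y else θ (m + 1)) * yCoeff k m (j - m)) • f (j - m)) else 0 := by
    intro m
    split_ifs <;> simp [mul_smul]
  have h3 : Finset.Icc 1 j = (Finset.Icc 1 k).filter (· ≤ j) := by
    ext m; simp; omega
  rw [h3, Finset.sum_filter]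
  simp only [← h2]
  rcases Nat.eq_zero_or_pos k with rfl | hk
  · simp [show j = 0 by omega]
  · rw [← Finset.insert_Icc_add_one_left_eq_Icc (show 1 ≤ k from hk), Finset.sum_insert (by simp), if_pos rfl]
    congr 1
    refine Finset.sum_congr rfl fun m hm => ?_
    have hm1 : m ≠ 1 := by have := (Finset.mem_Icc.1 hm).1; omega
    rw [if_neg hm1]

end

section

variable {V : Type*} [NormedAddCommGroup V] [NormedSpace ℝ V]

/-! ### Smooth functions -/

theorem _root_.ContDiffOn.hasDerivAt_of_isOpen {J : Set ℝ} (hJ : IsOpen J) {u : ℝ → V}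
    (hu : ContDiffOn ℝ ∞ u J) {t : ℝ} (ht : t ∈ J) : HasDerivAt u (deriv u t) t :=
  ((hu.differentiableOn (by simp)).differentiableAt (hJ.mem_nhds ht)).hasDerivAt

theorem _root_.ContDiffOn.deriv_infty {J : Set ℝ} (hJ : IsOpen J) {u : ℝ → V}
    (hu : ContDiffOn ℝ ∞ u J) : ContDiffOn ℝ ∞ (deriv u) J :=
  ((contDiffOn_infty_iff_deriv_of_isOpen hJ).1 hu).2

theorem _root_.ContDiffOn.iteratedDeriv_infty {J : Set ℝ} (hJ : IsOpen J) {u : ℝ → V}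
    (hu : ContDiffOn ℝ ∞ u J) (i : ℕ) : ContDiffOn ℝ ∞ (iteratedDeriv i u) J := by
  induction i with
  | zero => simpa using hu
  | succ i ih => rw [iteratedDeriv_succ]; exact ih.deriv_infty hJ

theorem deriv_eqOn {J : Set ℝ} (hJ : IsOpen J) {u w : ℝ → V} (h : ∀ t ∈ J, u t = w t) :
    ∀ t ∈ J, deriv u t = deriv w t := fun _ ht =>
  Filter.EventuallyEq.deriv_eq (Filter.eventually_of_mem (hJ.mem_nhds ht) h)

theorem hasDerivAt_bilinForm [FiniteDimensional ℝ V] (b : LinearMap.BilinForm ℝ V) {u w : ℝ → V}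
    {u' w' : V} {t : ℝ} (hu : HasDerivAt u u' t) (hw : HasDerivAt w w' t) :
    HasDerivAt (fun s => b (u s) (w s)) (b u' (w t) + b (u t) w') t := by
  have h := (LinearMap.toContinuousLinearMap
    (LinearMap.toContinuousLinearMap.toLinearMap ∘ₗ b)).hasDerivAt_of_bilinear
      (fun _ => hu) (fun _ => hw)
  rw [add_comm]
  exact h

/-- The coordinates with respect to a smooth frame depend smoothly on the parameter. -/
theorem exists_smooth_coordinates [FiniteDimensional ℝ V] {ι : Type*} [Fintype ι] [Nonempty ι]
    (hcard : Fintype.card ι = Module.finrank ℝ V) {J : Set ℝ} (hJ : IsOpen J) {e : ℝ → ι → V}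
    (he : ∀ i, ContDiffOn ℝ ∞ (fun t => e t i) J) (hli : ∀ t ∈ J, LinearIndependent ℝ (e t)) :
    ∃ Ψ : ℝ → V →L[ℝ] (ι → ℝ), ContDiffOn ℝ ∞ Ψ J ∧ ∀ t ∈ J,
      (∀ w, ∑ i, Ψ t w i • e t i = w) ∧ ∀ a : ι → ℝ, Ψ t (∑ i, a i • e t i) = a := by
  let Φ : ℝ → (ι → ℝ) →L[ℝ] V := fun t => ∑ i, (ContinuousLinearMap.proj i).smulRight (e t i)
  have hΦ : ContDiffOn ℝ ∞ Φ J := ContDiffOn.sum fun i _ => contDiffOn_const.smulRight (he i)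
  have hequiv : ∀ t ∈ J, ∃ L : (ι → ℝ) ≃L[ℝ] V, (L : (ι → ℝ) →L[ℝ] V) = Φ t := by
    intro t ht
    let B := basisOfLinearIndependentOfCardEqFinrank (hli t ht) hcard
    refine ⟨B.equivFun.symm.toContinuousLinearEquiv, ?_⟩
    ext a
    simp [Φ, B, Module.Basis.equivFun_symm_apply]
  have hΦa : ∀ t a, Φ t a = ∑ i, a i • e t i := by intro t a; simp [Φ]
  -- Inversion of operators is smooth at invertible ones, so the inverse of the frame map is smooth
  -- in `t`.
  refine ⟨fun t => ContinuousLinearMap.inverse (Φ t), ?_, ?_⟩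
  · intro t ht
    obtain ⟨L, hL⟩ := hequiv t ht
    have h1 : ContDiffAt ℝ ∞ ContinuousLinearMap.inverse (Φ t) := hL ▸ contDiffAt_map_inverse L
    exact (h1.comp t (hΦ.contDiffAt (hJ.mem_nhds ht))).contDiffWithinAt
  · intro t ht
    obtain ⟨L, hL⟩ := hequiv t ht
    simp only [← hΦa, ← hL, ContinuousLinearMap.inverse_equiv]
    simp

/-! ### Smooth combinations of the first derivatives of a curve -/

/-- On `J`, the vector-valued function `u` is a linear combination of the derivatives of `v` of
order less than `n`, with smooth coefficients. -/
inductive IsComb (v : ℝ → V) (J : Set ℝ) : ℕ → (ℝ → V) → Prop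
  | basis {i n : ℕ} (h : i < n) : IsComb v J n (iteratedDeriv i v)
  | zero {n : ℕ} : IsComb v J n 0
  | add {n : ℕ} {u w : ℝ → V} (hu : IsComb v J n u) (hw : IsComb v J n w) : IsComb v J n (u + w)
  | smul {n : ℕ} {f : ℝ → ℝ} {u : ℝ → V} (hf : ContDiffOn ℝ ∞ f J) (hu : IsComb v J n u) :
      IsComb v J n (fun t => f t • u t)
  | congr {n : ℕ} {u w : ℝ → V} (hu : IsComb v J n u) (h : ∀ t ∈ J, w t = u t) : IsComb v J n w

namespace IsComb

variable {v : ℝ → V} {J : Set ℝ} {n : ℕ} {u w : ℝ → V}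

theorem mono {m : ℕ} (h : IsComb v J n u) (hnm : n ≤ m) : IsComb v J m u := by
  induction h with
  | basis h => exact .basis (h.trans_le hnm)
  | zero => exact .zero
  | add _ _ ih1 ih2 => exact .add (ih1 hnm) (ih2 hnm)
  | smul hf _ ih => exact .smul hf (ih hnm)
  | congr _ h ih => exact .congr (ih hnm) h

theorem neg (h : IsComb v J n u) : IsComb v J n (-u) :=
  .congr (.smul (contDiffOn_const (c := (-1 : ℝ))) h) fun t _ => by simp

theorem sub (hu : IsComb v J n u) (hw : IsComb v J n w) : IsComb v J n (u - w) := by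
  rw [sub_eq_add_neg]; exact .add hu hw.neg

theorem sum {ι : Type*} (s : Finset ι) {f : ι → ℝ → V} (h : ∀ i ∈ s, IsComb v J n (f i)) :
    IsComb v J n (fun t => ∑ i ∈ s, f i t) := by
  classical
  induction s using Finset.induction_on with
  | empty => exact .congr .zero fun t _ => by simp
  | insert a s ha ih =>
    refine .congr (.add (h a (by simp)) (ih fun i hi => h i (by simp [hi]))) fun t _ => ?_
    simp [Finset.sum_insert ha]

theorem contDiffOn (hJ : IsOpen J) (hv : ContDiffOn ℝ ∞ v J) (h : IsComb v J n u) :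
    ContDiffOn ℝ ∞ u J := by
  induction h with
  | basis h => exact hv.iteratedDeriv_infty hJ _
  | zero => exact contDiffOn_const
  | add _ _ ih1 ih2 => exact ih1.add ih2
  | smul hf _ ih => exact hf.smul ih
  | congr _ h ih => exact ih.congr h

theorem deriv (hJ : IsOpen J) (hv : ContDiffOn ℝ ∞ v J) (h : IsComb v J n u) :
    IsComb v J (n + 1) (deriv u) := by
  induction h with
  | basis h => rw [← iteratedDeriv_succ]; exact .basis (by omega)
  | zero => exact .congr .zero fun t _ => by simp
  | add h1 h2 ih1 ih2 =>
    refine .congr (.add ih1 ih2) fun t ht => ?_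
    exact (((h1.contDiffOn hJ hv).hasDerivAt_of_isOpen hJ ht).add
      ((h2.contDiffOn hJ hv).hasDerivAt_of_isOpen hJ ht)).deriv
  | smul hf h ih =>
    refine .congr (.add (.smul hf ih) (.smul (hf.deriv_infty hJ) (h.mono (Nat.le_succ _))))
      fun t ht => ?_
    exact ((hf.hasDerivAt_of_isOpen hJ ht).smul
      ((h.contDiffOn hJ hv).hasDerivAt_of_isOpen hJ ht)).deriv
  | congr _ h ih => exact .congr ih (deriv_eqOn hJ h)

theorem mem_span (h : IsComb v J n u) {t : ℝ} (ht : t ∈ J) :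
    u t ∈ Submodule.span ℝ {w | ∃ j < n, w = iteratedDeriv j v t} := by
  induction h with
  | basis h => exact Submodule.subset_span ⟨_, h, rfl⟩
  | zero => exact Submodule.zero_mem _
  | add _ _ ih1 ih2 => exact Submodule.add_mem _ ih1 ih2
  | smul hf _ ih => exact Submodule.smul_mem _ _ ih
  | congr _ h ih => rw [h t ht]; exact ih

theorem eq_zero (h : IsComb v J 0 u) {t : ℝ} (ht : t ∈ J) : u t = 0 := by
  simpa using h.mem_span ht

/-- Isolates a smooth coefficient at the top derivative, which is what each normalization below has
to kill. -/
theorem exists_leading (h : IsComb v J (n + 1) u) :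
    ∃ a : ℝ → ℝ, ContDiffOn ℝ ∞ a J ∧ IsComb v J n (fun t => u t - a t • iteratedDeriv n v t) := by
  generalize hm : n + 1 = m at h
  induction h with
  | @basis i _ h =>
    rcases Nat.lt_succ_iff_lt_or_eq.1 (hm ▸ h) with h | rfl
    · exact ⟨0, contDiffOn_const, .congr (.basis h) fun t _ => by simp⟩
    · exact ⟨1, contDiffOn_const, .congr .zero fun t _ => by simp⟩
  | zero => exact ⟨0, contDiffOn_const, .congr .zero fun t _ => by simp⟩
  | add _ _ ih1 ih2 =>
    obtain ⟨a, ha, h1⟩ := ih1 hm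
    obtain ⟨b, hb, h2⟩ := ih2 hm
    refine ⟨a + b, ha.add hb, .congr (.add h1 h2) fun t _ => ?_⟩
    simp only [Pi.add_apply, add_smul]
    abel
  | @smul _ f _ hf _ ih =>
    obtain ⟨a, ha, h1⟩ := ih hm
    refine ⟨fun t => f t * a t, hf.mul ha, .congr (.smul hf h1) fun t _ => ?_⟩
    simp only [smul_sub, mul_smul]
  | congr _ h ih =>
    obtain ⟨a, ha, h1⟩ := ih hm
    exact ⟨a, ha, .congr h1 fun t ht => by rw [h t ht]⟩

/-- A triangular change of the generating curve preserves the order filtration; used to pass from a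
lift to a rescaled one. -/
theorem trans {v' : ℝ → V} (h : IsComb v J n u)
    (hv : ∀ i < n, IsComb v' J (i + 1) (iteratedDeriv i v)) : IsComb v' J n u := by
  induction h with
  | basis h => exact (hv _ h).mono h
  | zero => exact .zero
  | add _ _ ih1 ih2 => exact .add (ih1 hv) (ih2 hv)
  | smul hf _ ih => exact .smul hf (ih hv)
  | congr _ h ih => exact .congr (ih hv) h

/-- The two leading terms of the derivatives of a product. -/
theorem iteratedDeriv_smul (hJ : IsOpen J) (hv : ContDiffOn ℝ ∞ v J) {f : ℝ → ℝ}
    (hf : ContDiffOn ℝ ∞ f J) (hw : ∀ t ∈ J, w t = f t • v t) (j : ℕ) :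
    IsComb v J j (fun t => iteratedDeriv (j + 1) w t - f t • iteratedDeriv (j + 1) v t
      - ((j + 1 : ℝ) * _root_.deriv f t) • iteratedDeriv j v t) := by
  have hv' := fun i => hv.iteratedDeriv_infty hJ i
  have hf' := hf.deriv_infty hJ
  induction j with
  | zero =>
    refine .congr .zero fun t ht => ?_
    have h1 := deriv_eqOn hJ hw t ht
    have h2 := ((hf.hasDerivAt_of_isOpen hJ ht).smul (hv.hasDerivAt_of_isOpen hJ ht)).deriv
    simp only [zero_add, iteratedDeriv_one, iteratedDeriv_zero, h1, Nat.cast_zero]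
    have h3 : _root_.deriv (fun s => f s • v s) t = _ := h2
    rw [h3]
    simp
  | succ j ih =>
    have hd := ih.deriv hJ hv
    have hwj : ContDiffOn ℝ ∞ (iteratedDeriv (j + 1) w) J :=
      ((hf.smul hv).congr hw).iteratedDeriv_infty hJ _
    -- Differentiating the previous remainder also produces `-(j + 1) f'' v^{(j)}`; this has
    -- admissible order and is added back.
    refine .congr (.add hd (.smul (f := fun t => ((j : ℝ) + 1) * _root_.deriv (_root_.deriv f) t)
      (contDiffOn_const.mul (hf'.deriv_infty hJ)) (.basis (i := j) (Nat.lt_succ_self j))))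
      fun t ht => ?_
    have h1 := ((hwj.hasDerivAt_of_isOpen hJ ht).sub ((hf.hasDerivAt_of_isOpen hJ ht).smul
      ((hv' (j + 1)).hasDerivAt_of_isOpen hJ ht))).sub
      (((hf'.hasDerivAt_of_isOpen hJ ht).const_mul ((j : ℝ) + 1)).smul
        ((hv' j).hasDerivAt_of_isOpen hJ ht))
    rw [Pi.add_apply]
    have h2 : _root_.deriv (fun t => iteratedDeriv (j + 1) w t - f t • iteratedDeriv (j + 1) v t
      - ((j + 1 : ℝ) * _root_.deriv f t) • iteratedDeriv j v t) t = _ := h1.deriv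
    rw [h2]
    simp only [iteratedDeriv_succ, Nat.cast_add, Nat.cast_one]
    module

theorem iteratedDeriv_smul' (hJ : IsOpen J) (hv : ContDiffOn ℝ ∞ v J) {f : ℝ → ℝ}
    (hf : ContDiffOn ℝ ∞ f J) (hw : ∀ t ∈ J, w t = f t • v t) (j : ℕ) :
    IsComb v J j (fun t => iteratedDeriv j w t - f t • iteratedDeriv j v t) := by
  cases j with
  | zero => exact .congr .zero fun t ht => by simp [hw t ht]
  | succ j =>
    refine .congr (.add ((iteratedDeriv_smul hJ hv hf hw j).mono (Nat.le_succ j)) (.smul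
      (f := fun t => ((j : ℝ) + 1) * _root_.deriv f t)
      (contDiffOn_const.mul (hf.deriv_infty hJ)) (.basis (Nat.lt_succ_self j)))) fun t _ => ?_
    simp

theorem iteratedDeriv_of_smul (hJ : IsOpen J) (hv : ContDiffOn ℝ ∞ v J) {f : ℝ → ℝ}
    (hf : ContDiffOn ℝ ∞ f J) (hw : ∀ t ∈ J, w t = f t • v t) (j : ℕ) :
    IsComb v J (j + 1) (iteratedDeriv j w) :=
  .congr (.add ((iteratedDeriv_smul' hJ hv hf hw j).mono (Nat.le_succ j))
    (.smul hf (.basis (Nat.lt_succ_self j)))) fun t _ => by simp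

end IsComb

end

section

/-! ### Triangular changes of frame -/

variable {V : Type*} [AddCommGroup V] [Module ℝ V]

theorem span_eq_of_triangular {f g : ℕ → V} {c : ℕ → ℝ} {N : ℕ} (hc : ∀ j < N, c j ≠ 0)
    (h : ∀ j < N, f j - c j • g j ∈ Submodule.span ℝ {w | ∃ i < j, w = g i}) {n : ℕ} (hn : n ≤ N) :
    Submodule.span ℝ {w | ∃ j < n, w = f j} = Submodule.span ℝ {w | ∃ j < n, w = g j} := by
  induction n with
  | zero => simp
  | succ n ih =>
    have ih := ih (by omega)
    have hm : ∀ u : ℕ → V, Submodule.span ℝ {w | ∃ j < n, w = u j} ≤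
        Submodule.span ℝ {w | ∃ j < n + 1, w = u j} := fun u =>
      Submodule.span_mono fun w ⟨j, hj, hw⟩ => ⟨j, by omega, hw⟩
    have hn' := h n (by omega)
    apply le_antisymm <;> rw [Submodule.span_le]
    · rintro w ⟨j, hj, rfl⟩
      rcases Nat.lt_succ_iff_lt_or_eq.1 hj with hj | rfl
      · exact hm g (ih ▸ Submodule.subset_span ⟨j, hj, rfl⟩)
      · rw [← sub_add_cancel (f j) (c j • g j)]
        exact Submodule.add_mem _ (hm g hn')
          (Submodule.smul_mem _ _ (Submodule.subset_span ⟨j, Nat.lt_succ_self j, rfl⟩))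
    · rintro w ⟨j, hj, rfl⟩
      rcases Nat.lt_succ_iff_lt_or_eq.1 hj with hj | rfl
      · exact hm f (ih ▸ Submodule.subset_span ⟨j, hj, rfl⟩)
      · have : g j = (c j)⁻¹ • (f j - (f j - c j • g j)) := by
          rw [sub_sub_cancel, inv_smul_smul₀ (hc j (by omega))]
        rw [this]
        exact Submodule.smul_mem _ _ (Submodule.sub_mem _
          (Submodule.subset_span ⟨j, Nat.lt_succ_self j, rfl⟩) (hm f (ih ▸ hn')))

theorem linearIndependent_of_triangular {k : ℕ} (hdim : Module.finrank ℝ V = k + 1)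
    {f g : ℕ → V} {c : ℕ → ℝ} (hc : ∀ j < k + 1, c j ≠ 0)
    (h : ∀ j < k + 1, f j - c j • g j ∈ Submodule.span ℝ {w | ∃ i < j, w = g i})
    (hg : LinearIndependent ℝ (fun i : Fin (k + 1) => g i)) :
    LinearIndependent ℝ (fun i : Fin (k + 1) => f i) := by
  have : FiniteDimensional ℝ V := Module.finite_of_finrank_eq_succ hdim
  have hr : ∀ u : ℕ → V, Set.range (fun i : Fin (k + 1) => u i) = {w | ∃ j < k + 1, w = u j} := by
    intro u; ext w
    exact ⟨fun ⟨i, hi⟩ => ⟨i, i.2, hi.symm⟩, fun ⟨j, hj, hw⟩ => ⟨⟨j, hj⟩, hw.symm⟩⟩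
  apply linearIndependent_of_top_le_span_of_card_eq_finrank _ (by simp [hdim])
  rw [hr, span_eq_of_triangular hc h le_rfl, ← hr,
    hg.span_eq_top_of_card_eq_finrank' (by simp [hdim])]

end

section

variable {V : Type*} [NormedAddCommGroup V] [NormedSpace ℝ V]

/-! ### Lifts and osculating spaces -/

/-- A smooth curve in `V` whose derivatives of order at most `k` are independent on `U`. -/
structure IsNondegenerateCurve (k : ℕ) (v : ℝ → V) (U : Set ℝ) : Prop where
  smooth : ContDiffOn ℝ ∞ v U
  linearIndependent : ∀ t ∈ U, LinearIndependent ℝ (fun i : Fin (k + 1) => iteratedDeriv (i : ℕ) v t)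

variable {k : ℕ} {J U : Set ℝ} {γ : ℝ → Projectivization ℝ V} {v : ℝ → V}

theorem IsNondegenerateCurve.mono (h : IsNondegenerateCurve k v J) (hU : U ⊆ J) :
    IsNondegenerateCurve k v U :=
  ⟨h.smooth.mono hU, fun t ht => h.linearIndependent t (hU ht)⟩

theorem IsNondegenerateCurve.exists_coordinates [FiniteDimensional ℝ V]
    (hdim : Module.finrank ℝ V = k + 1) (h : IsNondegenerateCurve k v J) (hJ : IsOpen J)
    {u : ℝ → V} (hu : ContDiffOn ℝ ∞ u J) :
    ∃ a : Fin (k + 1) → ℝ → ℝ, (∀ i, ContDiffOn ℝ ∞ (a i) J) ∧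
      ∀ t ∈ J, u t = ∑ i, a i t • iteratedDeriv (i : ℕ) v t := by
  obtain ⟨Ψ, hΨ, h1⟩ := exists_smooth_coordinates (ι := Fin (k + 1)) (by simp [hdim]) hJ
    (fun i => h.smooth.iteratedDeriv_infty hJ i) h.linearIndependent
  exact ⟨fun i t => Ψ t (u t) i, fun i => contDiffOn_pi.1 (hΨ.clm_apply hu) i,
    fun t ht => ((h1 t ht).1 (u t)).symm⟩

theorem IsNondegenerateCurve.isComb [FiniteDimensional ℝ V]
    (hdim : Module.finrank ℝ V = k + 1) (h : IsNondegenerateCurve k v J) (hJ : IsOpen J)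
    {u : ℝ → V} (hu : ContDiffOn ℝ ∞ u J) : IsComb v J (k + 1) u := by
  obtain ⟨a, ha, h1⟩ := h.exists_coordinates hdim hJ hu
  exact .congr (.sum Finset.univ fun i _ => .smul (ha i) (.basis i.2)) h1

/-- The factor is the zeroth coordinate in the smooth frame `v, v', …, v^{(k)}`, hence smooth. -/
theorem IsNondegenerateCurve.exists_smooth_factor [FiniteDimensional ℝ V]
    (hdim : Module.finrank ℝ V = k + 1) (h : IsNondegenerateCurve k v J) (hJ : IsOpen J)
    {w : ℝ → V} (hw : ContDiffOn ℝ ∞ w J) (hs : ∀ t ∈ J, w t ∈ Submodule.span ℝ {v t}) :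
    ∃ f : ℝ → ℝ, ContDiffOn ℝ ∞ f J ∧ ∀ t ∈ J, w t = f t • v t := by
  obtain ⟨a, ha, h1⟩ := h.exists_coordinates hdim hJ hw
  refine ⟨a 0, ha 0, fun t ht => ?_⟩
  obtain ⟨r, hr⟩ := Submodule.mem_span_singleton.1 (hs t ht)
  have h2 : ∑ i : Fin (k + 1), (a i t - if i = 0 then r else 0) • iteratedDeriv (i : ℕ) v t = 0 := by
    simp [sub_smul, Finset.sum_sub_distrib, ← h1 t ht, hr]
  have h3 := Fintype.linearIndependent_iff.1 (h.linearIndependent t ht) _ h2 0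
  rw [if_pos rfl, sub_eq_zero] at h3
  rw [h3, hr]

/-- Any other lift is a smooth multiple of `v`, so by the Leibniz rule its derivatives add nothing
to the span. -/
theorem IsNondegenerateCurve.osculatingSpace_eq [FiniteDimensional ℝ V]
    (hdim : Module.finrank ℝ V = k + 1) (h : IsNondegenerateCurve k v J) (hJ : IsOpen J)
    (hv : IsLift γ J v) (i : ℕ) {t : ℝ} (ht : t ∈ J) :
    osculatingSpace γ J i t = Submodule.span ℝ {w | ∃ j < i + 1, w = iteratedDeriv j v t} := by
  apply le_antisymm <;> refine Submodule.span_le.2 ?_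
  · rintro _ ⟨w, hw, j, hj, rfl⟩
    obtain ⟨f, hf, hwf⟩ := h.exists_smooth_factor hdim hJ hw.smooth fun s hs => by
      rw [← hv.span_eq s hs, hw.span_eq s hs]
      exact Submodule.mem_span_singleton_self _
    exact ((IsComb.iteratedDeriv_of_smul hJ h.smooth hf hwf j).mono (by omega)).mem_span ht
  · rintro _ ⟨j, hj, rfl⟩
    exact Submodule.subset_span ⟨v, hv, j, by omega, rfl⟩

theorem osculatingSpace_mono {i j : ℕ} (hij : i ≤ j) (t : ℝ) :
    osculatingSpace γ J i t ≤ osculatingSpace γ J j t :=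
  Submodule.span_mono fun _ ⟨v, hv, l, hl, hw⟩ => ⟨v, hv, l, hl.trans hij, hw⟩

/-! ### A lift with constant Wronskian -/

theorem exists_smooth_antideriv (hJo : IsOpen J) (hJc : J.OrdConnected) (hJn : J.Nonempty)
    {p : ℝ → ℝ} (hp : ContDiffOn ℝ ∞ p J) :
    ∃ q : ℝ → ℝ, ContDiffOn ℝ ∞ q J ∧ ∀ t ∈ J, deriv q t = p t := by
  obtain ⟨t₀, ht₀⟩ := hJn
  have hd : ∀ t ∈ J, HasDerivAt (fun s => ∫ x in t₀..s, p x) (p t) t := fun t ht =>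
    intervalIntegral.integral_hasDerivAt_right
      ((hp.continuousOn.mono (hJc.uIcc_subset ht₀ ht)).intervalIntegrable)
      (hp.continuousOn.stronglyMeasurableAtFilter hJo t ht)
      (hp.continuousOn.continuousAt (hJo.mem_nhds ht))
  refine ⟨_, (contDiffOn_infty_iff_deriv_of_isOpen hJo).2
    ⟨fun t ht => (hd t ht).differentiableAt.differentiableWithinAt, hp.congr fun t ht =>
      (hd t ht).deriv⟩, fun t ht => (hd t ht).deriv⟩

theorem exists_normalized_lift [FiniteDimensional ℝ V] (hdim : Module.finrank ℝ V = k + 1)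
    (hJo : IsOpen J) (hJc : J.OrdConnected) (hJn : J.Nonempty) (hγ : IsNondegenerate k γ J) :
    ∃ v : ℝ → V, IsLift γ J v ∧ IsNondegenerateCurve k v J ∧
      IsComb v J k (iteratedDeriv (k + 1) v) := by
  obtain ⟨v, hv, hli⟩ := hγ
  have h : IsNondegenerateCurve k v J := ⟨hv.smooth, hli⟩
  obtain ⟨p, hp, hpc⟩ := (h.isComb hdim hJo (hv.smooth.iteratedDeriv_infty hJo (k + 1))).exists_leading
  obtain ⟨q, hq, hqd⟩ := exists_smooth_antideriv hJo hJc hJn hp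
  -- With `v^{(k+1)} = p v^{(k)} + …`, the component of `(f v)^{(k+1)}` along `v^{(k)}` is `f p + (k
  -- + 1) f'`; this `f` makes it zero.
  let f : ℝ → ℝ := fun t => Real.exp (-(q t / (k + 1)))
  have hf : ContDiffOn ℝ ∞ f J := (hq.div_const _).neg.exp
  have hf0 : ∀ t, f t ≠ 0 := fun t => (Real.exp_pos _).ne'
  have hfd : ∀ t ∈ J, (k + 1 : ℝ) * deriv f t = -(f t * p t) := by
    intro t ht
    have h1 := ((hq.hasDerivAt_of_isOpen hJo ht).div_const (k + 1 : ℝ)).neg.exp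
    have h2 : deriv f t = _ := h1.deriv
    have h3 : (k + 1 : ℝ) ≠ 0 := by positivity
    rw [h2, hqd t ht]
    simp only [f]
    field_simp
    simp [mul_comm]
  let w : ℝ → V := fun t => f t • v t
  have hw : ∀ t ∈ J, w t = f t • v t := fun _ _ => rfl
  have hv' : ∀ t ∈ J, v t = (f t)⁻¹ • w t := fun t _ => (inv_smul_smul₀ (hf0 t) _).symm
  have hws : ContDiffOn ℝ ∞ w J := hf.smul hv.smooth
  refine ⟨w, ⟨hws, fun t ht => ?_⟩, ⟨hws, fun t ht => ?_⟩, ?_⟩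
  · rw [hv.span_eq t ht]
    exact (Submodule.span_singleton_smul_eq (IsUnit.mk0 _ (hf0 t)) _).symm
  · exact linearIndependent_of_triangular hdim (f := fun j => iteratedDeriv j w t)
      (g := fun j => iteratedDeriv j v t) (c := fun _ => f t) (fun _ _ => hf0 t)
      (fun j _ => (IsComb.iteratedDeriv_smul' hJo hv.smooth hf hw j).mem_span ht) (hli t ht)
  · refine IsComb.trans (v := v) ?_ fun i _ =>
      IsComb.iteratedDeriv_of_smul hJo hws (hf.inv fun t _ => hf0 t) hv' i
    refine .congr (.add (IsComb.iteratedDeriv_smul hJo hv.smooth hf hw k) (.smul hf hpc))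
      fun t ht => ?_
    simp only [Pi.add_apply, hfd t ht]
    module

end

section

variable {V : Type*} [NormedAddCommGroup V] [NormedSpace ℝ V]

/-! ### Existence of a canonical frame -/

/-- The moving frame obtained from `v` by solving the structure equations with coefficients `1`, `0`
and `c m` at `x`, `h` and `y ^ m`. -/
noncomputable def frameSeq (k : ℕ) (v : ℝ → V) (c : ℕ → ℝ → ℝ) : ℕ → ℝ → V
  | 0 => v
  | j + 1 => fun t => deriv (frameSeq k v c j) t -
      ∑ i : Fin j, (c (j - i) t * yCoeff k (j - i) i) • frameSeq k v c i t

theorem frameSeq_succ (k : ℕ) (v : ℝ → V) (c : ℕ → ℝ → ℝ) (j : ℕ) (t : ℝ) :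
    frameSeq k v c (j + 1) t = deriv (frameSeq k v c j) t -
      ∑ m ∈ Finset.Icc 1 j, (c m t * yCoeff k m (j - m)) • frameSeq k v c (j - m) t := by
  rw [frameSeq]
  simp only
  rw [← Finset.sum_range (fun i => (c (j - i) t * yCoeff k (j - i) i) • frameSeq k v c i t)]
  congr 1
  refine Finset.sum_nbij' (fun i => j - i) (fun m => j - m) ?_ ?_ ?_ ?_ ?_
  · intro i hi; simp at hi ⊢; omega
  · intro m hm; simp at hm ⊢; omega
  · intro i hi; simp at hi; omega
  · intro m hm; simp at hm; omega
  · intro i hi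
    simp at hi
    rw [show j - (j - i) = i by omega]

variable {k : ℕ} {J : Set ℝ} {v : ℝ → V} {c c' : ℕ → ℝ → ℝ}

theorem frameSeq_sub_iteratedDeriv (hJ : IsOpen J) (hv : ContDiffOn ℝ ∞ v J)
    (hc : ∀ m, ContDiffOn ℝ ∞ (c m) J) (j : ℕ) :
    IsComb v J j (fun t => frameSeq k v c j t - iteratedDeriv j v t) := by
  induction j using Nat.strong_induction_on with
  | _ j ih =>
    have hE : ∀ i < j, IsComb v J (i + 1) (frameSeq k v c i) := fun i hi =>
      .congr (.add ((ih i hi).mono (Nat.le_succ i)) (.basis (Nat.lt_succ_self i)))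
        fun t _ => by simp
    cases j with
    | zero => exact .congr .zero fun t _ => by simp [frameSeq]
    | succ j =>
      have hd := (ih j (by omega)).deriv hJ hv
      refine .congr (.sub hd (.sum (Finset.Icc 1 j) (f := fun m t =>
        (c m t * yCoeff k m (j - m)) • frameSeq k v c (j - m) t) fun m hm =>
          .smul ((hc m).mul contDiffOn_const) ((hE (j - m) (by omega)).mono (by
            have := Finset.mem_Icc.1 hm; omega)))) fun t ht => ?_
      have h1 : deriv (fun t => frameSeq k v c j t - iteratedDeriv j v t) t = _ :=
        ((((hE j (by omega)).contDiffOn hJ hv).hasDerivAt_of_isOpen hJ ht).sub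
          ((hv.iteratedDeriv_infty hJ j).hasDerivAt_of_isOpen hJ ht)).deriv
      rw [Pi.sub_apply, h1, frameSeq_succ, iteratedDeriv_succ]
      abel

theorem frameSeq_isComb (hJ : IsOpen J) (hv : ContDiffOn ℝ ∞ v J)
    (hc : ∀ m, ContDiffOn ℝ ∞ (c m) J) (j : ℕ) : IsComb v J (j + 1) (frameSeq k v c j) :=
  .congr (.add ((frameSeq_sub_iteratedDeriv (k := k) hJ hv hc j).mono (Nat.le_succ j))
    (.basis (Nat.lt_succ_self j))) fun t _ => by simp

theorem frameSeq_congr {m : ℕ} (hcc : ∀ i < m, c' i = c i) {j : ℕ} (hj : j ≤ m) :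
    frameSeq k v c' j = frameSeq k v c j := by
  induction j using Nat.strong_induction_on with
  | _ j ih =>
    cases j with
    | zero => simp [frameSeq]
    | succ j =>
      funext t
      rw [frameSeq_succ, frameSeq_succ, ih j (by omega) (by omega)]
      congr 1
      refine Finset.sum_congr rfl fun i hi => ?_
      rw [hcc i (by have := Finset.mem_Icc.1 hi; omega), ih (j - i) (by omega) (by omega)]

/-- The effect on the frame of a change of the `m`-th coefficient. -/
theorem frameSeq_sub_frameSeq (hJ : IsOpen J) (hv : ContDiffOn ℝ ∞ v J)
    (hc : ∀ m, ContDiffOn ℝ ∞ (c m) J) (hc' : ∀ m, ContDiffOn ℝ ∞ (c' m) J) {m : ℕ} (hm : 1 ≤ m)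
    (hcc : ∀ i < m, c' i = c i) (l : ℕ) :
    IsComb v J l (fun t => frameSeq k v c' (l + m + 1) t - frameSeq k v c (l + m + 1) t
      + ((c' m t - c m t) * ∑ i ∈ Finset.range (l + 1), yCoeff k m i) • iteratedDeriv l v t) := by
  have hE := frameSeq_isComb (k := k) hJ hv hc
  have hE' := frameSeq_isComb (k := k) hJ hv hc'
  have hδ : ContDiffOn ℝ ∞ (fun t => c' m t - c m t) J := (hc' m).sub (hc m)
  induction l using Nat.strong_induction_on with
  | _ l ih =>
    -- Up to index `m` the two frames agree; beyond it the induction hypothesis bounds the order of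
    -- their difference.
    have hdiff : ∀ i < l + m + 1,
        IsComb v J l (fun t => frameSeq k v c' i t - frameSeq k v c i t) := by
      intro i hi
      rcases le_or_gt i m with him | him
      · exact .congr .zero fun t _ => by simp [frameSeq_congr hcc him]
      · obtain ⟨l', rfl⟩ : ∃ l', i = l' + m + 1 := ⟨i - m - 1, by omega⟩
        refine .mono (n := l' + 1) ?_ (by omega)
        exact .congr (.sub ((ih l' (by omega)).mono (Nat.le_succ l'))
          (.smul (hδ.mul (contDiffOn_const (c := ∑ i ∈ Finset.range (l' + 1), yCoeff k m i))) (.basis (Nat.lt_succ_self l')))) fun t _ => by simp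
    -- the sum of the coefficient terms
    have hsum : IsComb v J l (fun t => ∑ i ∈ Finset.Icc 1 (l + m),
        ((c' i t * yCoeff k i (l + m - i)) • frameSeq k v c' (l + m - i) t -
          (c i t * yCoeff k i (l + m - i)) • frameSeq k v c (l + m - i) t -
          if i = m then ((c' m t - c m t) * yCoeff k m l) • iteratedDeriv l v t else 0)) := by
      refine .sum _ fun i hi => ?_
      have hi := Finset.mem_Icc.1 hi
      have h1 : IsComb v J l (fun t => (c' i t * yCoeff k i (l + m - i)) •
          (frameSeq k v c' (l + m - i) t - frameSeq k v c (l + m - i) t)) :=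
        .smul ((hc' i).mul contDiffOn_const) (hdiff _ (by omega))
      -- Only `i = m` reaches order `l`: for `i < m` the coefficients agree, and for `i > m` the
      -- vectors `e_{l+m-i}` have order below `l`.
      rcases lt_trichotomy i m with him | rfl | him
      · refine .congr h1 fun t _ => ?_
        rw [hcc i him, if_neg him.ne, smul_sub, sub_zero]
      · refine .congr (.add h1 (.smul (hδ.mul (contDiffOn_const (c := yCoeff k i l)))
          (frameSeq_sub_iteratedDeriv (k := k) hJ hv hc l))) fun t _ => ?_
        simp only [if_pos, Nat.add_sub_cancel, Pi.add_apply]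
        module
      · refine .congr (.add h1 (.smul (((hc' i).sub (hc i)).mul
          (contDiffOn_const (c := yCoeff k i (l + m - i))))
          ((hE (l + m - i)).mono (by omega : l + m - i + 1 ≤ l)))) fun t _ => ?_
        simp only [if_neg him.ne', Pi.add_apply]
        module
    have hder : IsComb v J l (fun t => deriv (frameSeq k v c' (l + m)) t -
        deriv (frameSeq k v c (l + m)) t +
        ((c' m t - c m t) * ∑ i ∈ Finset.range l, yCoeff k m i) • iteratedDeriv l v t) := by
      cases l with
      | zero =>
        exact .congr .zero fun t _ => by simp [frameSeq_congr hcc le_rfl]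
      | succ l =>
        have h1 := (ih l (by omega)).deriv hJ hv
        refine .congr (.sub h1 (.smul (hδ.deriv_infty hJ) (.smul (contDiffOn_const
          (c := ∑ i ∈ Finset.range (l + 1), yCoeff k m i)) (.basis (Nat.lt_succ_self l)))))
          fun t ht => ?_
        have h2 : deriv (fun t => frameSeq k v c' (l + m + 1) t - frameSeq k v c (l + m + 1) t
          + ((c' m t - c m t) * ∑ i ∈ Finset.range (l + 1), yCoeff k m i) •
            iteratedDeriv l v t) t = _ :=
          (((((hE' _).contDiffOn hJ hv).hasDerivAt_of_isOpen hJ ht).sub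
            (((hE _).contDiffOn hJ hv).hasDerivAt_of_isOpen hJ ht)).add
            (((hδ.hasDerivAt_of_isOpen hJ ht).mul_const _).smul
              ((hv.iteratedDeriv_infty hJ l).hasDerivAt_of_isOpen hJ ht))).deriv
        rw [Pi.sub_apply, h2, iteratedDeriv_succ, show l + 1 + m = l + m + 1 by omega]
        module
    refine .congr (.sub hder hsum) fun t _ => ?_
    rw [Pi.sub_apply, frameSeq_succ, frameSeq_succ, Finset.sum_sub_distrib, Finset.sum_sub_distrib,
      Finset.sum_ite_eq', if_pos (by simp; omega), Finset.sum_range_succ]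
    module

/-- Removes the components of `e_{k+1}` from the top down. After `m` steps it involves only
derivatives of order below `k - m`; for `m = k` it is zero. -/
theorem exists_frameSeq_isComb (hJ : IsOpen J) (hv : ContDiffOn ℝ ∞ v J)
    (hvk : IsComb v J k (iteratedDeriv (k + 1) v)) {m : ℕ} (hm : m ≤ k) :
    ∃ c : ℕ → ℝ → ℝ, (∀ i, ContDiffOn ℝ ∞ (c i) J) ∧
      IsComb v J (k - m) (frameSeq k v c (k + 1)) := by
  induction m with
  | zero =>
    refine ⟨fun _ _ => 0, fun _ => contDiffOn_const, .congr hvk fun t _ => ?_⟩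
    have : ∀ j, frameSeq k v (fun _ _ => 0) j = iteratedDeriv j v := by
      intro j
      induction j with
      | zero => simp [frameSeq]
      | succ j ih => funext t; rw [frameSeq_succ, ih, iteratedDeriv_succ]; simp
    rw [this]
  | succ m ih =>
    obtain ⟨c, hc, h⟩ := ih (by omega)
    obtain ⟨n, rfl⟩ : ∃ n, k = n + (m + 1) := ⟨k - (m + 1), by omega⟩
    rw [show n + (m + 1) - m = n + 1 by omega] at h
    rw [show n + (m + 1) - (m + 1) = n by omega]
    obtain ⟨a, ha, hr⟩ := h.exists_leading
    have hS : 0 < ∑ i ∈ Finset.range (n + 1), yCoeff (n + (m + 1)) (m + 1) i :=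
      Finset.sum_pos (fun i hi => yCoeff_pos (by have := Finset.mem_range.1 hi; omega)) (by simp)
    set S := ∑ i ∈ Finset.range (n + 1), yCoeff (n + (m + 1)) (m + 1) i with hSdef
    -- Raising `c (m + 1)` by `δ` changes the leading coefficient `a` by `-δ S`, and `S > 0`, so `δ
    -- = a / S` cancels it.
    let c' := Function.update c (m + 1) (fun t => c (m + 1) t + a t / S)
    have hc' : ∀ i, ContDiffOn ℝ ∞ (c' i) J := by
      intro i
      by_cases hi : i = m + 1
      · subst hi
        simpa [c'] using (hc (m + 1)).add (ha.div_const S)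
      · simpa [c', hi] using hc i
    refine ⟨c', hc', .congr (.add (frameSeq_sub_frameSeq (k := n + (m + 1)) hJ hv hc hc'
      (Nat.succ_pos m) (fun i hi => by simp [c', hi.ne]) n) hr) fun t _ => ?_⟩
    simp only [Pi.add_apply, ← hSdef]
    have : (c' (m + 1) t - c (m + 1) t) * S = a t := by
      simp [c']; field_simp
    rw [this, ← add_assoc n m 1]
    module

end

section

variable {V : Type*} [NormedAddCommGroup V] [NormedSpace ℝ V]
variable {k : ℕ} {J U : Set ℝ} {γ : ℝ → Projectivization ℝ V} {v : ℝ → V}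

theorem nonempty_canonicalFrame [FiniteDimensional ℝ V] (hdim : Module.finrank ℝ V = k + 1)
    (hJo : IsOpen J) (hJc : J.OrdConnected) (hJn : J.Nonempty) (hγ : IsNondegenerate k γ J) :
    Nonempty (CanonicalFrame k γ J J) := by
  obtain ⟨v, hv, h, hvk⟩ := exists_normalized_lift hdim hJo hJc hJn hγ
  obtain ⟨c, hc, hE⟩ := exists_frameSeq_isComb hJo h.smooth hvk le_rfl
  rw [Nat.sub_self] at hE
  have htri : ∀ t ∈ J, ∀ j < k + 1, frameSeq k v c j t - (1 : ℝ) • iteratedDeriv j v t ∈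
      Submodule.span ℝ {w | ∃ i < j, w = iteratedDeriv i v t} := fun t ht j _ => by
    rw [one_smul]
    exact (frameSeq_sub_iteratedDeriv hJo h.smooth hc j).mem_span ht
  have hsm : ∀ j, ContDiffOn ℝ ∞ (frameSeq k v c j) J := fun j =>
    (frameSeq_isComb hJo h.smooth hc j).contDiffOn hJo h.smooth
  refine ⟨{
    e := fun t j => frameSeq k v c j t
    cx := fun _ => 1
    ch := fun _ => 0
    cy := c 1
    -- The index shift is `θ_{m+1} = c m`, since `θ_{m+1}` belongs to `y ^ m`.
    θ := fun m => c (m - 1)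
    smooth := fun j => hsm j
    linearIndependent := fun t ht => linearIndependent_of_triangular hdim
      (f := fun j => frameSeq k v c j t) (c := fun _ => 1) (fun _ _ => one_ne_zero) (htri t ht)
      (h.linearIndependent t ht)
    adapted := fun t ht i => ?_
    structure_eq := fun t ht j => ?_ }⟩
  · rw [h.osculatingSpace_eq hdim hJo hv i ht, ← span_eq_of_triangular (c := fun _ => 1)
      (fun _ _ => one_ne_zero) (htri t ht) (by omega : (i : ℕ) + 1 ≤ k + 1)]
    congr 1
    ext w
    constructor
    · rintro ⟨j, hj, rfl⟩
      exact ⟨j, Nat.lt_succ_of_le hj, rfl⟩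
    · rintro ⟨j, hj, rfl⟩
      exact ⟨⟨j, by omega⟩, Nat.le_of_lt_succ hj, rfl⟩
  · have h1 := sum_maurerCartan_smul j.2 (fun i => frameSeq k v c i t) (hE.eq_zero ht) 1 0 (c 1 t)
      (fun m => c (m - 1) t)
    refine Eq.trans ?_ h1.symm
    simp only [frameSeq_succ, one_smul, zero_mul, zero_smul, add_zero]
    rw [sub_add_eq_add_sub, eq_sub_iff_add_eq]
    congr 1
    refine Finset.sum_congr rfl fun m hm => ?_
    split_ifs with h
    · rw [h]
    · rfl

/-! ### Structure equations -/

/-- The structure equations of a canonical frame `e 0, …, e k`, with coefficient functions `a`, `h`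
and `c m` at `x`, `h` and `y ^ m`. -/
structure IsCanonicalSeq (k : ℕ) (U : Set ℝ) (e : ℕ → ℝ → V) (a h : ℝ → ℝ) (c : ℕ → ℝ → ℝ) :
    Prop where
  smooth : ∀ j, ContDiffOn ℝ ∞ (e j) U
  linearIndependent : ∀ t ∈ U, LinearIndependent ℝ (fun i : Fin (k + 1) => e i t)
  eq_zero : ∀ t ∈ U, e (k + 1) t = 0
  hasDerivAt : ∀ t ∈ U, ∀ j ≤ k, HasDerivAt (e j) (a t • e (j + 1) t + (h t * (k - 2 * j)) • e j t
    + ∑ m ∈ Finset.Icc 1 j, (c m t * yCoeff k m (j - m)) • e (j - m) t) t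

namespace CanonicalFrame

/-- The frame extended by zero. -/
noncomputable def seq (F : CanonicalFrame k γ J U) (j : ℕ) (t : ℝ) : V :=
  if h : j < k + 1 then F.e t ⟨j, h⟩ else 0

/-- The coefficient at `y ^ m` of the Maurer-Cartan matrix. -/
noncomputable def coeff (F : CanonicalFrame k γ J U) (m : ℕ) (t : ℝ) : ℝ :=
  if m = 1 then F.cy t else F.θ (m + 1) t

theorem seq_of_lt (F : CanonicalFrame k γ J U) {j : ℕ} (h : j < k + 1) :
    F.seq j = fun t => F.e t ⟨j, h⟩ := by
  funext t; simp [seq, h]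

theorem isCanonicalSeq (F : CanonicalFrame k γ J U) (hU : IsOpen U) :
    IsCanonicalSeq k U F.seq F.cx F.ch F.coeff where
  smooth j := by
    by_cases h : j < k + 1
    · rw [F.seq_of_lt h]; exact F.smooth _
    · have : F.seq j = fun _ => 0 := by funext t; simp [seq, h]
      rw [this]; exact contDiffOn_const
  linearIndependent t ht := by
    have : (fun i : Fin (k + 1) => F.seq i t) = F.e t := by funext i; rw [F.seq_of_lt i.2]
    rw [this]; exact F.linearIndependent t ht
  eq_zero t _ := by simp [seq]
  hasDerivAt t ht j hj := by
    have hj' : j < k + 1 := by omega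
    have h1 := (F.smooth ⟨j, hj'⟩).hasDerivAt_of_isOpen hU ht
    rw [F.structure_eq t ht] at h1
    have h2 := sum_maurerCartan_smul hj' (fun i => F.seq i t) (by simp [seq]) (F.cx t) (F.ch t)
      (F.cy t) (fun m => F.θ m t)
    have h3 : ∀ i : Fin (k + 1), F.seq i t = F.e t i := fun i => by rw [F.seq_of_lt i.2]
    simp only [h3] at h2
    rw [h2, ← F.seq_of_lt hj'] at h1
    exact h1

theorem seq_mem (F : CanonicalFrame k γ J U) {t : ℝ} (ht : t ∈ U) {j : ℕ} (hj : j ≤ k) :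
    F.seq j t ∈ osculatingSpace γ J j t := by
  have h := F.adapted t ht ⟨j, by omega⟩
  rw [F.seq_of_lt (by omega : j < k + 1)]
  exact h ▸ Submodule.subset_span ⟨_, le_rfl, rfl⟩

/-- If `cx` vanished at `t`, then `e_0'` would be proportional to `e_0 = f v`; independence of `v`
and `v'` would give `f t = 0`, hence `e_0 = 0`. -/
theorem cx_ne_zero [FiniteDimensional ℝ V] (hk : 1 ≤ k) (hdim : Module.finrank ℝ V = k + 1)
    (hJ : IsOpen J) (hγ : IsNondegenerate k γ J) (F : CanonicalFrame k γ J U) (hU : IsOpen U)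
    (hUJ : U ⊆ J) {t : ℝ} (ht : t ∈ U) : F.cx t ≠ 0 := by
  intro h0
  obtain ⟨v, hv, hli⟩ := hγ
  have hn : IsNondegenerateCurve k v J := ⟨hv.smooth, hli⟩
  have hF := F.isCanonicalSeq hU
  obtain ⟨f, hf, hfe⟩ := (hn.mono hUJ).exists_smooth_factor hdim hU (hF.smooth 0) fun s hs => by
    have h1 := F.seq_mem hs (Nat.zero_le k)
    rw [hn.osculatingSpace_eq hdim hJ hv 0 (hUJ hs)] at h1
    simpa using h1
  have hd1 := hF.hasDerivAt t ht 0 (Nat.zero_le k)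
  have hd2 : HasDerivAt (F.seq 0) (f t • deriv v t + deriv f t • v t) t :=
    ((hf.hasDerivAt_of_isOpen hU ht).smul
      ((hv.smooth.mono hUJ).hasDerivAt_of_isOpen hU ht)).congr_of_eventuallyEq
      (Filter.eventually_of_mem (hU.mem_nhds ht) hfe)
  have heq := hd1.unique hd2
  simp only [h0, hfe t ht, zero_smul, zero_add, Nat.cast_zero, mul_zero, sub_zero,
    Finset.Icc_eq_empty_of_lt zero_lt_one, Finset.sum_empty, add_zero] at heq
  have hpair := LinearIndependent.pair_iff.1 ((hli t (hUJ ht)).comp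
    ![(⟨0, by omega⟩ : Fin (k + 1)), ⟨1, by omega⟩] (by
      intro i j hij; fin_cases i <;> fin_cases j <;> simp_all)  |> fun h =>
      (by convert h using 1; ext i; fin_cases i <;> simp :
        LinearIndependent ℝ ![v t, deriv v t]))
      (deriv f t - F.ch t * k * f t) (f t) (by
        rw [sub_smul, mul_smul, heq]; abel)
  have h2 := (hF.linearIndependent t ht).ne_zero ⟨0, by omega⟩
  exact h2 (by simp [hfe t ht, hpair.2])

end CanonicalFrame

end

section

/-! ### The Gram matrix of a form in a canonical frame -/

/-- Summing the increments gives `K * ∑ p = q d - q (k + 1) = 0` with a positive sum. -/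
theorem eq_zero_of_telescoping {K : ℝ} {p q : ℕ → ℝ} {d k : ℕ} (hdk : d ≤ k) (hd : q d = 0)
    (hk : q (k + 1) = 0) (hp : ∀ i, d ≤ i → i ≤ k → 0 < p i)
    (h : ∀ i, d ≤ i → i ≤ k → q i - q (i + 1) = K * p i) :
    K = 0 ∧ ∀ i, d ≤ i → i ≤ k + 1 → q i = 0 := by
  have hsum : ∀ n, d ≤ n → n ≤ k + 1 → q n = -(K * ∑ i ∈ Finset.Ico d n, p i) := by
    intro n hn
    induction n, hn using Nat.le_induction with
    | base => intro _; simp [hd]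
    | succ n hn ih =>
      intro hn'
      have h1 := h n hn (by omega)
      rw [Finset.sum_Ico_succ_top hn, mul_add, ← h1, neg_add, ← ih (by omega)]
      ring
  have hpos : 0 < ∑ i ∈ Finset.Ico d (k + 1), p i :=
    Finset.sum_pos (fun i hi => hp i (Finset.mem_Ico.1 hi).1 (by
      have := (Finset.mem_Ico.1 hi).2; omega)) ⟨d, by simp; omega⟩
  have hK : K = 0 := by
    have h1 := hsum (k + 1) (by omega) le_rfl
    rw [hk] at h1
    rcases mul_eq_zero.1 (neg_eq_zero.1 h1.symm) with h2 | h2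
    · exact h2
    · exact absurd h2 hpos.ne'
  exact ⟨hK, fun i hi hi' => by rw [hsum i hi hi', hK]; simp⟩

variable {V : Type*} [NormedAddCommGroup V] [NormedSpace ℝ V] [FiniteDimensional ℝ V]
variable {k : ℕ} {U : Set ℝ} {e : ℕ → ℝ → V} {a h : ℝ → ℝ} {c : ℕ → ℝ → ℝ}

namespace IsCanonicalSeq

theorem hasDerivAt_gram (he : IsCanonicalSeq k U e a h c) (b : LinearMap.BilinForm ℝ V) {t : ℝ}
    (ht : t ∈ U) {i j : ℕ} (hi : i ≤ k) (hj : j ≤ k) :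
    HasDerivAt (fun s => b (e i s) (e j s))
      (a t * (b (e (i + 1) t) (e j t) + b (e i t) (e (j + 1) t))
        + h t * (2 * k - 2 * (i + j)) * b (e i t) (e j t)
        + (∑ m ∈ Finset.Icc 1 i, c m t * yCoeff k m (i - m) * b (e (i - m) t) (e j t)
          + ∑ m ∈ Finset.Icc 1 j, c m t * yCoeff k m (j - m) * b (e i t) (e (j - m) t))) t := by
  convert hasDerivAt_bilinForm b (he.hasDerivAt t ht i hi) (he.hasDerivAt t ht j hj) using 1
  simp only [map_add, map_smul, map_sum, LinearMap.add_apply, LinearMap.smul_apply,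
    LinearMap.sum_apply, smul_eq_mul]
  ring

variable {b : LinearMap.BilinForm ℝ V}

/-- Differentiating the zero entries on `i + j = k - 1` leaves only the `x`-term, so neighbouring
antidiagonal entries are opposite. -/
theorem gram_antidiagonal (he : IsCanonicalSeq k U e a h c) (hU : IsOpen U)
    (ha : ∀ t ∈ U, a t ≠ 0) (hb : ∀ t ∈ U, ∀ i j, i + j < k → b (e i t) (e j t) = 0)
    {t : ℝ} (ht : t ∈ U) {i j : ℕ} (hij : i + j = k) :
    b (e i t) (e j t) = (-1) ^ i * b (e 0 t) (e k t) := by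
  induction i generalizing j with
  | zero => simp [show j = k by omega]
  | succ i ih =>
    have h1 := he.hasDerivAt_gram b ht (by omega : i ≤ k) (by omega : j ≤ k)
    have h2 : HasDerivAt (fun s => b (e i s) (e j s)) 0 t :=
      (hasDerivAt_const t (0 : ℝ)).congr_of_eventuallyEq
        (Filter.eventually_of_mem (hU.mem_nhds ht) fun s hs => hb s hs i j (by omega))
    have h3 := h1.unique h2
    rw [hb t ht i j (by omega), Finset.sum_eq_zero fun m _ => by
        rw [hb t ht (i - m) j (by omega), mul_zero],
      Finset.sum_eq_zero fun m _ => by rw [hb t ht i (j - m) (by omega), mul_zero]] at h3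
    simp only [mul_zero, add_zero, mul_eq_zero, ha t ht, false_or] at h3
    rw [eq_neg_of_add_eq_zero_left h3, ih (by omega), pow_succ]
    ring

/-- Induction over the diagonals below the antidiagonal: differentiating the diagonal `i + j = k +
d` controls `i + j = k + d + 1` and yields the condition on `c d`. At `d = k + 1` all entries and
all powers of `y` are covered. -/
theorem gram_eq_zero_and_coeff (he : IsCanonicalSeq k U e a h c) (hU : IsOpen U)
    (ha : ∀ t ∈ U, a t ≠ 0) (hb : ∀ t ∈ U, ∀ i j, i + j < k → b (e i t) (e j t) = 0) (d : ℕ)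
    (hd : d ≤ k + 1) :
    (∀ t ∈ U, ∀ i j, i ≤ k → j ≤ k → k < i + j → i + j ≤ k + d → b (e i t) (e j t) = 0) ∧
      ∀ m, Even m → 1 ≤ m → m < d → ∀ t ∈ U, c m t * b (e 0 t) (e k t) = 0 := by
  induction d with
  | zero => exact ⟨fun t _ i j _ _ h1 h2 => by omega, fun m _ _ h => by omega⟩
  | succ d ih =>
    obtain ⟨ihM, ihc⟩ := ih (by omega)
    have hanti := fun t ht i j hij => he.gram_antidiagonal hU ha hb (t := t) ht (i := i) (j := j) hij
    -- the entries on the diagonal `i + j = k + d + 1`, with alternating signs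
    have key : ∀ t ∈ U, ∃ K : ℝ, ∃ p : ℕ → ℝ, (∀ i, d ≤ i → i ≤ k → 0 < p i) ∧
        (∀ i, d ≤ i → i ≤ k → (-1) ^ i * b (e i t) (e (k + d + 1 - i) t) -
          (-1) ^ (i + 1) * b (e (i + 1) t) (e (k + d + 1 - (i + 1)) t) = K * p i) ∧
        (1 ≤ d → Even d → K = 0 → c d t * b (e 0 t) (e k t) = 0) := by
      intro t ht
      rcases Nat.eq_zero_or_pos d with rfl | hd0
      · have hderiv := he.hasDerivAt_gram b ht (Nat.zero_le k) le_rfl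
        -- For `d = 0` the differentiated entries are `(-1) ^ i * M_{0k}`, so the common increment
        -- is `M_{0k}' / a`.
        refine ⟨deriv (fun s => b (e 0 s) (e k s)) t / a t, fun _ => 1, fun _ _ _ => one_pos,
          fun i _ hi => ?_, fun h => by omega⟩
        have h1 := he.hasDerivAt_gram b ht hi (Nat.sub_le k i)
        have h2 : HasDerivAt (fun s => b (e i s) (e (k - i) s))
            ((-1) ^ i * deriv (fun s => b (e 0 s) (e k s)) t) t :=
          (hderiv.differentiableAt.hasDerivAt.const_mul _).congr_of_eventuallyEq
            (Filter.eventually_of_mem (hU.mem_nhds ht) fun s hs => hanti s hs i _ (by omega))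
        have h3 := h1.unique h2
        have hcast : (2 * k - 2 * (i + (k - i : ℕ)) : ℝ) = 0 := by
          rw [← Nat.cast_add, Nat.add_sub_cancel' hi]; ring
        rw [hcast, Finset.sum_eq_zero fun m hm => by
            rw [hb t ht (i - m) (k - i) (by have := Finset.mem_Icc.1 hm; omega), mul_zero],
          Finset.sum_eq_zero fun m hm => by
            rw [hb t ht i (k - i - m) (by have := Finset.mem_Icc.1 hm; omega), mul_zero]] at h3
        rw [show k + 0 + 1 - i = k - i + 1 by omega, show k + 0 + 1 - (i + 1) = k - i by omega,
          mul_one, eq_div_iff (ha t ht)]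
        have hsq : ((-1 : ℝ) ^ i) * (-1) ^ i = 1 := by rw [← mul_pow]; simp
        calc _ = (-1 : ℝ) ^ i * (a t * (b (e (i + 1) t) (e (k - i) t) +
              b (e i t) (e (k - i + 1) t))) := by ring
          _ = _ := by
            have h4 : a t * (b (e (i + 1) t) (e (k - i) t) + b (e i t) (e (k - i + 1) t)) =
              (-1) ^ i * deriv (fun s => b (e 0 s) (e k s)) t := by rw [← h3]; ring
            rw [h4, ← mul_assoc, hsq, one_mul]
      -- The factor `(-1) ^ d + 1` comes from `y ^ d` acting on both arguments: it is zero for odd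
      -- `d` and two for even `d`.
      · refine ⟨-(c d t * b (e 0 t) (e k t) * ((-1) ^ d + 1)) / a t, fun i => yCoeff k d (i - d),
          fun i hi hi' => yCoeff_pos (by omega), fun i hi hi' => ?_, fun _ hdE hK => ?_⟩
        · obtain ⟨i, rfl⟩ : ∃ i', i = i' + d := ⟨i - d, by omega⟩
          obtain ⟨j, rfl⟩ : ∃ j, k = i + d + j := ⟨k - (i + d), by omega⟩
          have h1 := he.hasDerivAt_gram b ht hi' (by omega : j + d ≤ i + d + j)
          have h2 : HasDerivAt (fun s => b (e (i + d) s) (e (j + d) s)) 0 t :=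
            (hasDerivAt_const t (0 : ℝ)).congr_of_eventuallyEq
              (Filter.eventually_of_mem (hU.mem_nhds ht) fun s hs =>
                ihM s hs _ _ (by omega) (by omega) (by omega) (by omega))
          have h3 := h1.unique h2
          -- Only `m = d` lands on the antidiagonal; smaller `m` give entries killed by induction,
          -- larger `m` entries killed by compatibility.
          rw [Finset.sum_eq_single d (fun m hm hmd => by
              have hm := Finset.mem_Icc.1 hm
              rcases lt_or_gt_of_ne hmd with hlt | hlt
              · rw [ihM t ht (i + d - m) (j + d) (by omega) (by omega) (by omega) (by omega),
                  mul_zero]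
              · rw [hb t ht (i + d - m) (j + d) (by omega), mul_zero])
              (fun hn => absurd (Finset.mem_Icc.2 ⟨hd0, by omega⟩) hn),
            Finset.sum_eq_single d (fun m hm hmd => by
              have hm := Finset.mem_Icc.1 hm
              rcases lt_or_gt_of_ne hmd with hlt | hlt
              · rw [ihM t ht (i + d) (j + d - m) (by omega) (by omega) (by omega) (by omega),
                  mul_zero]
              · rw [hb t ht (i + d) (j + d - m) (by omega), mul_zero])
              (fun hn => absurd (Finset.mem_Icc.2 ⟨hd0, by omega⟩) hn),
            ihM t ht (i + d) (j + d) (by omega) (by omega) (by omega) (by omega),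
            Nat.add_sub_cancel, Nat.add_sub_cancel, hanti t ht i (j + d) (by omega),
            hanti t ht (i + d) j (by omega),
            yCoeff_symm (show j + d + i = i + d + j by omega)] at h3
          rw [show i + d + j + d + 1 - (i + d) = j + d + 1 by omega,
            show i + d + j + d + 1 - (i + d + 1) = j + d by omega]
          simp only [Nat.add_sub_cancel]
          rw [div_mul_eq_mul_div, eq_div_iff (ha t ht)]
          have hsq : ((-1 : ℝ) ^ i) * (-1) ^ i = 1 := by rw [← mul_pow]; simp
          have hsd : ((-1 : ℝ) ^ d) * (-1) ^ d = 1 := by rw [← mul_pow]; simp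
          linear_combination ((-1 : ℝ) ^ i * (-1) ^ d) * h3 -
            c d t * yCoeff (i + d + j) d i * b (e 0 t) (e (i + d + j) t) *
              ((-1) ^ d * hsq + hsd * ((-1) ^ i * (-1) ^ i) + hsq)
        · rw [div_eq_zero_iff, neg_eq_zero, mul_eq_zero, hdE.neg_one_pow] at hK
          rcases hK with (hK | hK) | hK
          · exact hK
          · norm_num at hK
          · exact absurd hK (ha t ht)
    have key2 : ∀ t ∈ U, (1 ≤ d → Even d → c d t * b (e 0 t) (e k t) = 0) ∧
        ∀ i, d ≤ i → i ≤ k + 1 → (-1) ^ i * b (e i t) (e (k + d + 1 - i) t) = 0 := by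
      intro t ht
      obtain ⟨K, p, hp, hq, hK⟩ := key t ht
      -- Both boundary values contain `e_{k+1} = 0`.
      obtain ⟨hK0, hz⟩ := eq_zero_of_telescoping (by omega)
        (q := fun i => (-1) ^ i * b (e i t) (e (k + d + 1 - i) t))
        (by simp [show k + d + 1 - d = k + 1 by omega, he.eq_zero t ht])
        (by simp [he.eq_zero t ht]) hp hq
      exact ⟨fun h1 h2 => hK h1 h2 hK0, hz⟩
    refine ⟨fun t ht i j hi hj hij hijd => ?_, fun m hm hm1 hmd t ht => ?_⟩
    · rcases Nat.lt_or_ge (i + j) (k + d + 1) with hlt | hge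
      · exact ihM t ht i j hi hj hij (by omega)
      · have h1 := (key2 t ht).2 i (by omega) (by omega)
        rw [show k + d + 1 - i = j by omega] at h1
        exact (mul_eq_zero.1 h1).resolve_left (pow_ne_zero _ (by norm_num))
    · rcases Nat.lt_succ_iff_lt_or_eq.1 hmd with hlt | rfl
      · exact ihc m hm hm1 hlt t ht
      · exact (key2 t ht).1 hm1 hm

end IsCanonicalSeq

end

section

variable {V : Type*} [NormedAddCommGroup V] [NormedSpace ℝ V]
variable {k : ℕ} {J U : Set ℝ} {γ : ℝ → Projectivization ℝ V} {b : LinearMap.BilinForm ℝ V}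

/-! ### Bilinear forms -/

theorem neg_one_pow_eq_of_add_eq {i j k : ℕ} (h : i + j = k) : (-1 : ℝ) ^ j = (-1) ^ (k + i) := by
  rw [← h, show i + j + i = j + 2 * i by ring, pow_add, pow_mul]
  simp

theorem bilinForm_eq_zero_of_mem_span {S T : Set V} (h : ∀ x ∈ S, ∀ y ∈ T, b x y = 0) {u w : V}
    (hu : u ∈ Submodule.span ℝ S) (hw : w ∈ Submodule.span ℝ T) : b u w = 0 := by
  induction hu using Submodule.span_induction with
  | mem x hx =>
    induction hw using Submodule.span_induction with
    | mem y hy => exact h x hx y hy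
    | zero => simp
    | add _ _ _ _ h1 h2 => simp [h1, h2]
    | smul _ _ _ h1 => simp [h1]
  | zero => simp
  | add _ _ _ _ h1 h2 => simp [h1, h2]
  | smul _ _ _ h1 => simp [h1]

theorem hasParitySymmetry_iff (hdim : Module.finrank ℝ V = k + 1) :
    HasParitySymmetry b ↔ ∀ u w, b w u = (-1) ^ k * b u w := by
  unfold HasParitySymmetry
  rw [hdim]
  rcases Nat.even_or_odd k with hk | hk
  · have h1 : Odd (k + 1) := hk.add_one
    have h2 : ¬ Even (k + 1) := Nat.not_even_iff_odd.2 h1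
    simp only [h1, h2, hk.neg_one_pow, one_mul, forall_const, false_imp_iff, and_true]
    exact ⟨fun h u w => h.eq w u, fun h => ⟨fun u w => h w u⟩⟩
  · have h1 : Even (k + 1) := hk.add_one
    have h2 : ¬ Odd (k + 1) := Nat.not_odd_iff_even.2 h1
    simp only [h1, h2, hk.neg_one_pow, neg_mul, one_mul, forall_const, false_imp_iff, true_and]
    exact ⟨fun h u w => (h.neg_eq u w).symm, fun h u => by have := h u u; linarith⟩

theorem nondegenerate_of_separatingLeft (hb : ∀ u w, b w u = (-1) ^ k * b u w)
    (h : b.SeparatingLeft) : b.Nondegenerate :=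
  ⟨h, fun y hy => h y fun x => by rw [hb x y, hy x, mul_zero]⟩

theorem IsStronglyCompatible.isCompatible (h : IsStronglyCompatible k γ J b) :
    IsCompatible k γ J b := fun t ht i n hin u hu w hw =>
  h t ht i (n + 1) (by omega) u hu w (osculatingSpace_mono (Nat.le_succ n) t hw)

theorem IsStronglyCompatible.seq_eq_zero (h : IsStronglyCompatible k γ J b)
    (F : CanonicalFrame k γ J U) (hUJ : U ⊆ J) : ∀ t ∈ U, ∀ i j, i + j < k →
      b (F.seq i t) (F.seq j t) = 0 := fun t ht i j hij =>
  h t (hUJ ht) i (k - 1 - i) (by omega) _ (F.seq_mem ht (by omega)) _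
    (osculatingSpace_mono (by omega) t (F.seq_mem ht (by omega)))

variable [FiniteDimensional ℝ V]

/-- Differentiating the zero pairings shows that `b(v^{(i)}, v^{(n)})` with `i + n = k - 1`
alternates in sign along its diagonal. Between the ends this gives the sign `(-1) ^ (k - 1)`, while
the parity of `b` demands `(-1) ^ k`, so these pairings vanish. -/
theorem IsCompatible.isStronglyCompatible (hdim : Module.finrank ℝ V = k + 1)
    (hJ : IsOpen J) (hγ : IsNondegenerate k γ J) (h : IsCompatible k γ J b)
    (hb : HasParitySymmetry b) : IsStronglyCompatible k γ J b := by
  obtain ⟨v, hv, hli⟩ := hγ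
  have hn : IsNondegenerateCurve k v J := ⟨hv.smooth, hli⟩
  have hmem : ∀ t, t ∈ J → ∀ j, iteratedDeriv j v t ∈ osculatingSpace γ J j t := fun t _ j =>
    Submodule.subset_span ⟨v, hv, j, le_rfl, rfl⟩
  have hlow : ∀ t ∈ J, ∀ i n, i + n + 2 ≤ k → b (iteratedDeriv i v t) (iteratedDeriv n v t) = 0 :=
    fun t ht i n hin => h t ht i (k - 2 - i) (by omega) _ (hmem t ht i) _
      (osculatingSpace_mono (by omega) t (hmem t ht n))
  have hanti : ∀ t ∈ J, ∀ i n, i + n + 1 = k → b (iteratedDeriv i v t) (iteratedDeriv n v t) =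
      (-1) ^ i * b (iteratedDeriv 0 v t) (iteratedDeriv (k - 1) v t) := by
    intro t ht i
    induction i with
    | zero => intro n hin; simp [show k - 1 = n by omega]
    | succ i ih =>
      intro n hin
      have hd := fun j => (hv.smooth.iteratedDeriv_infty hJ j).hasDerivAt_of_isOpen hJ ht
      have h1 := (hasDerivAt_bilinForm b (hd i) (hd n)).unique
        ((hasDerivAt_const t (0 : ℝ)).congr_of_eventuallyEq
          (Filter.eventually_of_mem (hJ.mem_nhds ht) fun s hs => hlow s hs i n (by omega)))
      rw [← iteratedDeriv_succ, ← iteratedDeriv_succ] at h1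
      rw [eq_neg_of_add_eq_zero_left h1, ih (n + 1) (by omega), pow_succ]
      ring
  rw [hasParitySymmetry_iff hdim] at hb
  intro t ht i n hin u hu w hw
  have hz : b (iteratedDeriv 0 v t) (iteratedDeriv (k - 1) v t) = 0 := by
    have h1 := hanti t ht (k - 1) 0 (by omega)
    rw [hb] at h1
    have h2 : ((-1 : ℝ)) ^ k = -(-1) ^ (k - 1) := by
      conv_lhs => rw [show k = k - 1 + 1 by omega, pow_succ]
      ring
    rw [h2] at h1
    have h3 : (-1 : ℝ) ^ (k - 1) * b (iteratedDeriv 0 v t) (iteratedDeriv (k - 1) v t) = 0 := by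
      linarith
    exact (mul_eq_zero.1 h3).resolve_left (pow_ne_zero _ (by norm_num))
  rw [hn.osculatingSpace_eq hdim hJ hv _ ht] at hu hw
  refine bilinForm_eq_zero_of_mem_span ?_ hu hw
  rintro _ ⟨j, hj, rfl⟩ _ ⟨l, hl, rfl⟩
  by_cases hjl : j + l + 1 = k
  · rw [hanti t ht j l hjl, hz, mul_zero]
  · exact hlow t ht j l (by omega)

/-! ### Consequences of strong compatibility -/

/-- The Gram matrix in a canonical frame at one point is antidiagonal with entries proportional to
`(-1) ^ i`, so transposing it multiplies it by `(-1) ^ k`. -/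
theorem IsStronglyCompatible.hasParitySymmetry (hk : 1 ≤ k) (hdim : Module.finrank ℝ V = k + 1)
    (hJo : IsOpen J) (hJc : J.OrdConnected) (hJn : J.Nonempty) (hγ : IsNondegenerate k γ J)
    (h : IsStronglyCompatible k γ J b) : HasParitySymmetry b := by
  obtain ⟨F⟩ := nonempty_canonicalFrame hdim hJo hJc hJn hγ
  obtain ⟨t, ht⟩ := hJn
  have hF := F.isCanonicalSeq hJo
  have ha := fun s hs => F.cx_ne_zero hk hdim hJo hγ hJo subset_rfl (t := s) hs
  have hb := h.seq_eq_zero F subset_rfl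
  have hanti := fun i j hij => hF.gram_antidiagonal hJo ha hb ht (i := i) (j := j) hij
  have hhigh := (hF.gram_eq_zero_and_coeff hJo ha hb (k + 1) le_rfl).1 t ht
  have hzero : ∀ i j, i ≤ k → j ≤ k → i + j ≠ k → b (F.seq i t) (F.seq j t) = 0 := by
    intro i j hi hj hij
    rcases lt_or_gt_of_ne hij with hlt | hgt
    · exact hb t ht i j hlt
    · exact hhigh i j hi hj hgt (by omega)
  rw [hasParitySymmetry_iff hdim]
  let B := basisOfLinearIndependentOfCardEqFinrank (hF.linearIndependent t ht) (by simp [hdim])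
  have hBi : ∀ i, B i = F.seq i t := fun i => by simp [B]
  have hext : LinearMap.flip b = ((-1 : ℝ) ^ k) • b := by
    refine LinearMap.ext_basis B B fun i j => ?_
    rw [LinearMap.flip_apply, hBi, hBi, LinearMap.smul_apply, LinearMap.smul_apply, smul_eq_mul]
    by_cases hij : (i : ℕ) + j = k
    · rw [hanti i j hij, hanti j i (by omega), ← mul_assoc, ← pow_add]
      rw [neg_one_pow_eq_of_add_eq hij]
    · rw [hzero i j (by omega) (by omega) hij, hzero j i (by omega) (by omega) (by omega), mul_zero]
  intro u w
  have := LinearMap.congr_fun₂ hext u w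
  simpa using this

/-- Since `e_0` is already orthogonal to `e_0, …, e_{k-1}`, non-degeneracy forces `b(e_0, e_k) ≠ 0`,
which can be cancelled from `c (2 * i) * b(e_0, e_k) = 0`. -/
theorem IsStronglyCompatible.oddWilczynskiVanish (hk : 1 ≤ k) (hdim : Module.finrank ℝ V = k + 1)
    (hJ : IsOpen J) (hγ : IsNondegenerate k γ J) (hnd : b.Nondegenerate)
    (h : IsStronglyCompatible k γ J b) : OddWilczynskiVanish k γ J := by
  intro U hU hUJ F i hi hik t ht
  have hF := F.isCanonicalSeq hU
  have ha := fun s hs => F.cx_ne_zero hk hdim hJ hγ hU hUJ (t := s) hs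
  have hb := h.seq_eq_zero F hUJ
  have h1 := (hF.gram_eq_zero_and_coeff hU ha hb (k + 1) le_rfl).2 (2 * i) (even_two_mul i)
    (by omega) (by omega) t ht
  rw [CanonicalFrame.coeff, if_neg (by omega)] at h1
  refine (mul_eq_zero.1 h1).resolve_right fun h0 => ?_
  have hspan := (hF.linearIndependent t ht).span_eq_top_of_card_eq_finrank' (by simp [hdim])
  refine (hF.linearIndependent t ht).ne_zero 0 (hnd.1 _ fun w => ?_)
  refine bilinForm_eq_zero_of_mem_span (S := {F.seq 0 t}) ?_ (Submodule.mem_span_singleton_self _)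
    (hspan ▸ Submodule.mem_top : w ∈ Submodule.span ℝ (Set.range fun i : Fin (k + 1) => F.seq i t))
  rintro _ rfl _ ⟨j, rfl⟩
  by_cases hj : (j : ℕ) = k
  · simpa only [hj] using h0
  · exact hb t ht 0 j (by omega)

/-! ### Construction of a strongly compatible form -/

/-- The entries of the form that is invariant under the principal `sl(2)`. -/
noncomputable def invForm (k i j : ℕ) : ℝ := if i + j = k then (-1) ^ i else 0

/-- With respect to this form `x`, `h` and `y` are skew, hence so are the odd powers of `y`. In
entries, the two `y ^ d`-terms carry equal weights by `yCoeff_symm` and signs differing by `(-1) ^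
d`. -/
theorem invForm_invariant {i j : ℕ} (hi : i ≤ k) (hj : j ≤ k) (a h : ℝ) {c : ℕ → ℝ}
    (hc : ∀ m, Even m → 1 ≤ m → m ≤ k → c m = 0) :
    a * (invForm k (i + 1) j + invForm k i (j + 1)) + h * (2 * k - 2 * (i + j)) * invForm k i j
      + (∑ m ∈ Finset.Icc 1 i, c m * yCoeff k m (i - m) * invForm k (i - m) j
        + ∑ m ∈ Finset.Icc 1 j, c m * yCoeff k m (j - m) * invForm k i (j - m)) = 0 := by
  have h1 : invForm k (i + 1) j + invForm k i (j + 1) = 0 := by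
    unfold invForm
    rw [show i + (j + 1) = i + 1 + j by ring]
    split_ifs <;> ring
  have h2 : (2 * k - 2 * (i + j)) * invForm k i j = 0 := by
    unfold invForm
    split_ifs with hij
    · rw [← hij]; push_cast; ring
    · ring
  rw [h1, mul_assoc h, h2, mul_zero, mul_zero, zero_add, zero_add]
  have hne : ∀ p q, p + q ≠ k → invForm k p q = 0 := fun p q hpq => if_neg hpq
  rcases Nat.lt_or_ge k (i + j) with hlt | hge
  · obtain ⟨d, hd⟩ : ∃ d, i + j = k + d := ⟨i + j - k, by omega⟩
    rw [Finset.sum_eq_single d (fun m hm hmd => by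
        rw [hne _ _ (by have := Finset.mem_Icc.1 hm; omega), mul_zero])
        (fun hn => absurd (Finset.mem_Icc.2 ⟨by omega, by omega⟩) hn),
      Finset.sum_eq_single d (fun m hm hmd => by
        rw [hne _ _ (by have := Finset.mem_Icc.1 hm; omega), mul_zero])
        (fun hn => absurd (Finset.mem_Icc.2 ⟨by omega, by omega⟩) hn)]
    rcases Nat.even_or_odd d with hE | hO
    · rw [hc d hE (by omega) (by omega)]; ring
    · obtain ⟨i, rfl⟩ : ∃ i', i = i' + d := ⟨i - d, by omega⟩
      obtain ⟨j, rfl⟩ : ∃ j', j = j' + d := ⟨j - d, by omega⟩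
      rw [Nat.add_sub_cancel, Nat.add_sub_cancel, yCoeff_symm (show j + d + i = k by omega),
        invForm, invForm, if_pos (by omega), if_pos (by omega), pow_add, hO.neg_one_pow]
      ring
  · rw [Finset.sum_eq_zero fun m hm => by
        rw [hne _ _ (by have := Finset.mem_Icc.1 hm; omega), mul_zero],
      Finset.sum_eq_zero fun m hm => by
        rw [hne _ _ (by have := Finset.mem_Icc.1 hm; omega), mul_zero], add_zero]

/-- If the coefficients at even powers of `y` vanish, then the form with constant matrix `invForm`
in the moving frame is constant. -/
theorem IsCanonicalSeq.exists_bilinForm {e : ℕ → ℝ → V} {a h : ℝ → ℝ} {c : ℕ → ℝ → ℝ}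
    (he : IsCanonicalSeq k J e a h c) (hdim : Module.finrank ℝ V = k + 1)
    (hJo : IsOpen J) (hJc : J.OrdConnected) (hJn : J.Nonempty)
    (hc : ∀ t ∈ J, ∀ m, Even m → 1 ≤ m → m ≤ k → c m t = 0) :
    ∃ b : LinearMap.BilinForm ℝ V, ∀ t ∈ J, ∀ i j, i ≤ k → j ≤ k →
      b (e i t) (e j t) = invForm k i j := by
  obtain ⟨Ψ, hΨ, hΨe⟩ := exists_smooth_coordinates (ι := Fin (k + 1)) (by simp [hdim]) hJo
    (e := fun t i => e i t) (fun i => he.smooth i) he.linearIndependent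
  let β : LinearMap.BilinForm ℝ (Fin (k + 1) → ℝ) :=
    Matrix.toBilin' (Matrix.of fun i j => invForm k i j)
  -- `G t` has matrix `invForm` in the frame at `t`; the aim is that it is independent of `t`.
  let G : ℝ → LinearMap.BilinForm ℝ V := fun t => β.comp (Ψ t).toLinearMap (Ψ t).toLinearMap
  have hΨs : ∀ t ∈ J, ∀ i : Fin (k + 1), Ψ t (e i t) = Pi.single i 1 := by
    intro t ht i
    rw [← (hΨe t ht).2 (Pi.single i 1)]
    congr 1
    simp [Pi.single_apply]
  have hG : ∀ t ∈ J, ∀ i j, i ≤ k → j ≤ k → G t (e i t) (e j t) = invForm k i j := by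
    intro t ht i j hi hj
    have h1 := hΨs t ht ⟨i, by omega⟩
    have h2 := hΨs t ht ⟨j, by omega⟩
    simp only at h1 h2
    simp [G, β, h1, h2, Matrix.toBilin'_single]
  have hG' : ∀ t ∈ J, ∀ i j, i ≤ k + 1 → j ≤ k + 1 → (i ≤ k ∨ j ≤ k) →
      G t (e i t) (e j t) = invForm k i j := by
    intro t ht i j hi hj hij
    rcases Nat.lt_or_ge k i with hik | hik
    · rw [show i = k + 1 by omega, he.eq_zero t ht, invForm, if_neg (by omega)]; simp
    rcases Nat.lt_or_ge k j with hjk | hjk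
    · rw [show j = k + 1 by omega, he.eq_zero t ht, invForm, if_neg (by omega)]; simp
    exact hG t ht i j hik hjk
  have hder : ∀ t ∈ J, ∀ u w, HasDerivAt (fun s => G s u w) 0 t := by
    intro t ht u w
    have hΨd := hΨ.hasDerivAt_of_isOpen hJo ht
    have hΨu : ∀ u, HasDerivAt (fun s => Ψ s u) (deriv Ψ t u) t := fun u => by
      simpa using hΨd.clm_apply (hasDerivAt_const t u)
    have h1 := hasDerivAt_bilinForm β (hΨu u) (hΨu w)
    let B := basisOfLinearIndependentOfCardEqFinrank (he.linearIndependent t ht) (by simp [hdim])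
    have hBi : ∀ i, B i = e i t := fun i => by simp [B]
    have hD : β.comp (deriv Ψ t).toLinearMap (Ψ t).toLinearMap +
        β.comp (Ψ t).toLinearMap (deriv Ψ t).toLinearMap = 0 := by
      refine LinearMap.ext_basis B B fun i j => ?_
      have hi : (i : ℕ) ≤ k := Nat.le_of_lt_succ i.2
      have hj : (j : ℕ) ≤ k := Nat.le_of_lt_succ j.2
      have hed := fun l : Fin (k + 1) => (he.smooth l).hasDerivAt_of_isOpen hJo ht
      -- Differentiate the constant `Ψ s (e l s)`: this trades the derivative of the coordinates for
      -- that of the frame.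
      have h2 : ∀ l : Fin (k + 1), deriv Ψ t (e l t) = -Ψ t (deriv (e l) t) := fun l =>
        eq_neg_of_add_eq_zero_left ((hΨd.clm_apply (hed l)).unique
          ((hasDerivAt_const t (Pi.single l 1)).congr_of_eventuallyEq
            (Filter.eventually_of_mem (hJo.mem_nhds ht) fun s hs => hΨs s hs l)))
      -- The form is frozen at `t` while the frame moves, so the Gram derivative formula for a
      -- constant form applies.
      have h3 := (hasDerivAt_bilinForm (G t) (hed i) (hed j)).unique
        (he.hasDerivAt_gram (G t) ht hi hj)
      have h4 := invForm_invariant hi hj (a t) (h t) (hc t ht)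
      have hs1 : ∀ m ∈ Finset.Icc 1 (i : ℕ), c m t * yCoeff k m (i - m) *
          G t (e (i - m) t) (e j t) = c m t * yCoeff k m (i - m) * invForm k (i - m) j :=
        fun m _ => by rw [hG t ht (i - m) j (by omega) (by omega)]
      have hs2 : ∀ m ∈ Finset.Icc 1 (j : ℕ), c m t * yCoeff k m (j - m) *
          G t (e i t) (e (j - m) t) = c m t * yCoeff k m (j - m) * invForm k i (j - m) :=
        fun m _ => by rw [hG t ht i (j - m) (by omega) (by omega)]
      rw [hG' t ht _ _ (by omega) (by omega) (by omega),
        hG' t ht _ _ (by omega) (by omega) (by omega), hG t ht _ _ hi hj,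
        Finset.sum_congr rfl hs1, Finset.sum_congr rfl hs2, h4] at h3
      have h5 : β (Ψ t (deriv (e i) t)) (Ψ t (e j t)) +
        β (Ψ t (e i t)) (Ψ t (deriv (e j) t)) = 0 := h3
      rw [hBi, hBi]
      simp only [LinearMap.add_apply, LinearMap.BilinForm.comp_apply,
        ContinuousLinearMap.coe_coe, h2, map_neg, LinearMap.neg_apply, LinearMap.zero_apply]
      linarith
    have h6 := LinearMap.congr_fun₂ hD u w
    have h7 : β (deriv Ψ t u) (Ψ t w) + β (Ψ t u) (deriv Ψ t w) = 0 := h6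
    rw [h7] at h1
    exact h1
  obtain ⟨t₀, ht₀⟩ := hJn
  refine ⟨G t₀, fun t ht i j hi hj => ?_⟩
  rw [← hG t ht i j hi hj]
  exact hJo.is_const_of_deriv_eq_zero hJc.isPreconnected
    (f := fun s => G s (e i t) (e j t))
    (fun s hs => (hder s hs _ _).differentiableAt.differentiableWithinAt)
    (fun s hs => (hder s hs _ _).deriv) ht₀ ht

theorem OddWilczynskiVanish.exists_isStronglyCompatible (hdim : Module.finrank ℝ V = k + 1)
    (hJo : IsOpen J) (hJc : J.OrdConnected) (hJn : J.Nonempty) (hγ : IsNondegenerate k γ J)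
    (h : OddWilczynskiVanish k γ J) :
    ∃ b : LinearMap.BilinForm ℝ V, b.Nondegenerate ∧ HasParitySymmetry b ∧
      IsStronglyCompatible k γ J b := by
  obtain ⟨F⟩ := nonempty_canonicalFrame hdim hJo hJc hJn hγ
  have hF := F.isCanonicalSeq hJo
  obtain ⟨b, hb⟩ := hF.exists_bilinForm hdim hJo hJc hJn fun t ht m hm hm1 hmk => by
    obtain ⟨i, rfl⟩ := hm.two_dvd
    rw [CanonicalFrame.coeff, if_neg (by omega)]
    exact h J hJo subset_rfl F i (by omega) (by omega) t ht
  have hcompat : IsStronglyCompatible k γ J b := by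
    intro t ht i n hin u hu w hw
    rw [← F.adapted t ht ⟨i, by omega⟩] at hu
    rw [← F.adapted t ht ⟨n, by omega⟩] at hw
    refine bilinForm_eq_zero_of_mem_span ?_ hu hw
    rintro _ ⟨j, hj, rfl⟩ _ ⟨l, hl, rfl⟩
    have hj' : (j : ℕ) ≤ i := hj
    have hl' : (l : ℕ) ≤ n := hl
    have h1 := hb t ht j l (by omega) (by omega)
    rw [F.seq_of_lt j.2, F.seq_of_lt l.2, invForm, if_neg (by omega)] at h1
    exact h1
  obtain ⟨t, ht⟩ := hJn
  let B := basisOfLinearIndependentOfCardEqFinrank (hF.linearIndependent t ht) (by simp [hdim])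
  have hBi : ∀ i, B i = F.seq i t := fun i => by simp [B]
  have hsymm : ∀ u w, b w u = (-1) ^ k * b u w := by
    have hext : LinearMap.flip b = ((-1 : ℝ) ^ k) • b := by
      refine LinearMap.ext_basis B B fun i j => ?_
      rw [LinearMap.flip_apply, hBi, hBi, LinearMap.smul_apply, LinearMap.smul_apply, smul_eq_mul,
        hb t ht _ _ (by omega) (by omega), hb t ht _ _ (by omega) (by omega), invForm, invForm,
        add_comm (j : ℕ)]
      split_ifs with hij
      · rw [← pow_add, neg_one_pow_eq_of_add_eq hij]
      · simp
    intro u w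
    simpa using LinearMap.congr_fun₂ hext u w
  refine ⟨b, nondegenerate_of_separatingLeft hsymm fun u hu => ?_,
    (hasParitySymmetry_iff hdim).2 hsymm, hcompat⟩
  refine B.ext_elem fun i => ?_
  -- The matrix is antidiagonal, so pairing with `e_{k-i}` isolates the `i`-th coordinate of `u` up
  -- to sign.
  have h1 := hu (B ⟨k - i, by omega⟩)
  conv_lhs at h1 => rw [← B.sum_repr u]
  rw [map_sum, LinearMap.sum_apply, Finset.sum_eq_single i] at h1
  · rw [map_smul, LinearMap.smul_apply, hBi, hBi, hb t ht _ _ (by omega) (by simp), invForm,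
      if_pos (by simp; omega), smul_eq_mul] at h1
    simpa using h1
  · intro l _ hl
    have hl' : (l : ℕ) ≠ i := fun h' => hl (Fin.ext h')
    rw [map_smul, LinearMap.smul_apply, hBi, hBi, hb t ht _ _ (by omega) (by simp), invForm,
      if_neg (by simp; omega), smul_zero]
  · simp

end

end ProjCurve

theorem mainTheorem3 {V : Type*} [NormedAddCommGroup V] [NormedSpace ℝ V] [FiniteDimensional ℝ V]
    (k : ℕ) (hk : 1 ≤ k) (hdim : Module.finrank ℝ V = k + 1)
    (J : Set ℝ) (hJo : IsOpen J) (hJc : J.OrdConnected) (hJn : J.Nonempty)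
    (γ : ℝ → Projectivization ℝ V) (hγ : ProjCurve.IsNondegenerate k γ J) :
    -- canonical frames exist, so the invariants are defined on all of `J`
    Nonempty (ProjCurve.CanonicalFrame k γ J J) ∧
    -- existence of a compatible form of the right symmetry
    ((∃ b : LinearMap.BilinForm ℝ V, b.Nondegenerate ∧ ProjCurve.HasParitySymmetry b ∧
        ProjCurve.IsCompatible k γ J b) ↔ ProjCurve.OddWilczynskiVanish k γ J) ∧
    -- the same with the orthogonality of `γ^{(i)}` and `γ^{(k-1-i)}`, where the symmetry of the
    -- form is automatic
    (∀ b : LinearMap.BilinForm ℝ V, b.Nondegenerate → ProjCurve.IsStronglyCompatible k γ J b →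
        ProjCurve.HasParitySymmetry b) ∧
    ((∃ b : LinearMap.BilinForm ℝ V, b.Nondegenerate ∧ ProjCurve.IsStronglyCompatible k γ J b) ↔
        ProjCurve.OddWilczynskiVanish k γ J) :=
  ⟨ProjCurve.nonempty_canonicalFrame hdim hJo hJc hJn hγ,
    ⟨fun ⟨_, hb, hs, hc⟩ => (hc.isStronglyCompatible hdim hJo hγ hs).oddWilczynskiVanish hk hdim
        hJo hγ hb,
      fun h => let ⟨b, hb, hs, hc⟩ := h.exists_isStronglyCompatible hdim hJo hJc hJn hγ
        ⟨b, hb, hs, hc.isCompatible⟩⟩,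
    fun _ _ hc => hc.hasParitySymmetry hk hdim hJo hJc hJn hγ,
    ⟨fun ⟨_, hb, hc⟩ => hc.oddWilczynskiVanish hk hdim hJo hγ hb,
      fun h => let ⟨b, hb, _, hc⟩ := h.exists_isStronglyCompatible hdim hJo hJc hJn hγ
        ⟨b, hb, hc⟩⟩⟩
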